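/- **Setting.** Let $(\Lambda,\mathcal E)$ be a finite simple graph with graph distance $d(\cdot,\cdot)$, let $u\in[0,1]$, $\beta\in[0,\infty)$, $S\in\frac12\mathbb N$ and $\theta=2S+1$. *Random loops.* Let $\rho_u$ be the law of the Poisson point process on $\mathcal E\times[0,\beta]$ with two kinds of points, "crosses" of intensity $u$ and "double bars" of intensity $1-u$. A realization $\omega$ decomposes $\Lambda\times[0,\beta]_{\rm per}$ into a set $\mathcal L(\omega)$ of loops: a trajectory moves vertically (in the periodic time direction) until it meets a transition at its vertex; at a cross it jumps to the other endpoint of the edge and keeps its vertical direction, at a double bar it jumps to the other endpoint and reverses its vertical direction. Let $\mathbb P$ be the probability measure $\frac1Y\theta^{|\mathcal L(\omega)|}\,{\rm d}\rho_u(\omega)$ with $Y=\int\theta^{|\mathcal L(\omega)|}\,{\rm d}\rho_u(\omega)$, and let $E_{x,y,0}$ be the event that $(x,0)$ and $(y,0)$ belong to the same loop. *Quantum spins.* On $\bigotimes_{x\in\Lambda}\mathbb C^{2S+1}$ let $H=-\sum_{\{x,y\}\in\mathcal E}\bigl(u\,T_{xy}+(1-u)\,Q_{xy}-1\bigr)$,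 where $\langle a,b|T_{xy}|c,d\rangle=\delta_{a,d}\delta_{b,c}$ and $\langle a,b|Q_{xy}|c,d\rangle=\delta_{a,b}\delta_{c,d}$ in the basis of eigenvectors of the third spin operators $S^3_x,S^3_y$, with $a,b,c,d\in\{-S,\dots,S\}$. Let $\langle A\rangle={\rm Tr}\,A\,{\rm e}^{-\beta H}/{\rm Tr}\,{\rm e}^{-\beta H}$. **Theorem.** Let $C\in\mathbb R$, $u\in[0,1]$, $\beta\in[0,\infty)$ and $S\in\frac12\mathbb N$. There exists a constant $K$, depending only on $C,u,\beta,S$, such that for every finite graph $(\Lambda,\mathcal E)$ that is 2D-like with constant $C$, i.e. $\#\{y\in\Lambda: d(x,y)=k\}\le Ck$ for all $x\in\Lambda$ and all integers $k\ge1$, and for all $x,y\in\Lambda$, $$\langle S_x^3S_y^3\rangle=\tfrac13S(S+1)\,\mathbb P(E_{x,y,0}),$$ and, if $x\ne y$ are connected by a path, $$\tfrac13S(S+1)\,\mathbb P(E_{x,y,0})\le\frac{K}{\sqrt{\log(d(x,y)+1)}};$$ if $x$ and $y$ are not connected by a path (so that $d(x,y)=\infty$), then $\tfrac13S(S+1)\,\mathbb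 P(E_{x,y,0})=0$. Consequently there are no macroscopic loops for $\theta=2,3,4,\dots$, in the following sense: if $S\ge\frac12$, then for every $\varepsilon>0$ there is $N$, depending only on $C,u,\beta,S,\varepsilon$, such that for every finite graph that is 2D-like with constant $C$ and has $|\Lambda|\ge N$, and every $x\in\Lambda$, $$\frac1{|\Lambda|}\sum_{y\in\Lambda}\mathbb P(E_{x,y,0})\le\varepsilon .$$ -/

import Mathlib

open MeasureTheory Set

universe w

/-! ### Poisson point processes of finite intensity -/

/-- The law of the Poisson point process with finite intensity measure `ν` on `M`.
A realization is a finite family of points `(n, p₁, …, pₙ)`; the part with exactly `n` points has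
weight `e^{-ν(M)} / n!` times the product measure `ν ⊗ ⋯ ⊗ ν`.  (The labelling of the points is
irrelevant: everything below depends only on the unlabelled family.) -/
noncomputable def poissonProcess {M : Type*} [MeasurableSpace M] (ν : Measure M) :
    Measure (Σ n : ℕ, (Fin n → M)) :=
  ENNReal.ofReal (Real.exp (-(ν.real univ))) •
    Measure.sum fun n : ℕ =>
      ((Nat.factorial n : ENNReal)⁻¹) • (Measure.pi fun _ : Fin n => ν).map (Sigma.mk n)

/-! ### The model of random loops -/

namespace RandomLoops

variable {Λ : Type*} (G : SimpleGraph Λ)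

/-- The set of edges carries the discrete σ-algebra. -/
instance instMeasurableSpaceEdges : MeasurableSpace G.edgeSet := ⊤

/-- A transition: the edge where it occurs, its kind (`true` for a cross, `false` for a double
bar), and its time. -/
abbrev Transition : Type _ := G.edgeSet × Bool × ℝ

/-- A realization `ω`: a finite family of crosses and double bars. -/
abbrev Config : Type _ := Σ n : ℕ, (Fin n → Transition G)

/-- Intensity on `ℰ × {cross, double bar} × [0,β]`: Lebesgue measure in time, with rate `u` for
crosses and `1 - u` for double bars on every edge. -/
noncomputable def intensity (u β : ℝ) : Measure (Transition G) :=
  (Measure.count : Measure G.edgeSet).prod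
    ((ENNReal.ofReal u • Measure.dirac true + ENNReal.ofReal (1 - u) • Measure.dirac false).prod
      (volume.restrict (Icc 0 β)))

/-- The Poisson measure `ρ_u` on configurations of crosses and double bars. -/
noncomputable def rho (u β : ℝ) : Measure (Config G) := poissonProcess (intensity G u β)

variable {G}

namespace Config

/-- The edge of the `i`-th transition. -/
def edge (ω : Config G) (i : Fin ω.1) : Sym2 Λ := (ω.2 i).1

/-- The `i`-th transition is a cross (otherwise it is a double bar). -/
def IsCross (ω : Config G) (i : Fin ω.1) : Prop := (ω.2 i).2.1 = true

/-- The time of the `i`-th transition. -/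
def time (ω : Config G) (i : Fin ω.1) : ℝ := (ω.2 i).2.2

/-- No transition touches the vertex `x` at a time in `I`. -/
def Free (ω : Config G) (x : Λ) (I : Set ℝ) : Prop :=
  ∀ i, x ∈ ω.edge i → ω.time i ∉ I

/-- Points of `Λ × [0,β]` that are not in the support of `ω`. -/
def points (ω : Config G) (β : ℝ) : Set (Λ × ℝ) :=
  {p | p.2 ∈ Icc 0 β ∧ ω.Free p.1 {p.2}}

/-- Elementary pieces of the loop trajectories.  A trajectory moves vertically as long as no
transition is met; time is periodic; at a cross the trajectory goes to the other end of the edge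
and keeps its vertical direction; at a double bar it goes to the other end of the edge and reverses
its vertical direction. -/
inductive Step (ω : Config G) (β : ℝ) : Λ × ℝ → Λ × ℝ → Prop
  | vertical {x : Λ} {s t : ℝ} (hst : s ≤ t) (hfree : ω.Free x (Icc s t)) :
      Step ω β (x, s) (x, t)
  | period {x : Λ} : Step ω β (x, 0) (x, β)
  | cross {x y : Λ} {s t : ℝ} {i : Fin ω.1} (he : ω.edge i = s(x, y)) (hc : ω.IsCross i)
      (hs : s < ω.time i) (ht : ω.time i < t)
      (hx : ω.Free x (Ico s (ω.time i))) (hy : ω.Free y (Ioc (ω.time i) t)) :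
      Step ω β (x, s) (y, t)
  | barBelow {x y : Λ} {s t : ℝ} {i : Fin ω.1} (he : ω.edge i = s(x, y)) (hc : ¬ ω.IsCross i)
      (hs : s < ω.time i) (ht : t < ω.time i)
      (hx : ω.Free x (Ico s (ω.time i))) (hy : ω.Free y (Ico t (ω.time i))) :
      Step ω β (x, s) (y, t)
  | barAbove {x y : Λ} {s t : ℝ} {i : Fin ω.1} (he : ω.edge i = s(x, y)) (hc : ¬ ω.IsCross i)
      (hs : ω.time i < s) (ht : ω.time i < t)
      (hx : ω.Free x (Ioc (ω.time i) s)) (hy : ω.Free y (Ioc (ω.time i) t)) :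
      Step ω β (x, s) (y, t)

/-- Two points are equivalent if a trajectory, followed in either direction, joins them. -/
def loopSetoid (ω : Config G) (β : ℝ) : Setoid (ω.points β) :=
  Relation.EqvGen.setoid fun p q => Step ω β p.1 q.1

/-- The set `ℒ(ω)` of loops; loops are considered modulo reparametrization, so that a loop is
determined by its support. -/
def Loops (ω : Config G) (β : ℝ) : Type _ := Quotient (ω.loopSetoid β)

/-- The number `|ℒ(ω)|` of loops. -/
noncomputable def numLoops (ω : Config G) (β : ℝ) : ℕ := Nat.card (ω.Loops β)

/-- The loop that contains a given point. -/
def loopOf (ω : Config G) (β : ℝ) (p : ω.points β) : ω.Loops β :=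
  Quotient.mk (ω.loopSetoid β) p

end Config

/-- The event `E_{x,y,t}`: the points `(x,0)` and `(y,t)` belong to the same loop. -/
def sameLoop (G : SimpleGraph Λ) (β : ℝ) (x y : Λ) (t : ℝ) : Set (Config G) :=
  {ω | ∃ (hx : (x, 0) ∈ ω.points β) (hy : (y, t) ∈ ω.points β),
    ω.loopOf β ⟨(x, 0), hx⟩ = ω.loopOf β ⟨(y, t), hy⟩}

variable (G)

/-- The partition function `Y = ∫ θ^{|ℒ(ω)|} dρ_u(ω)`. -/
noncomputable def partitionFunction (u β θ : ℝ) : ENNReal :=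
  ∫⁻ ω, ENNReal.ofReal θ ^ ω.numLoops β ∂(rho G u β)

/-- The probability measure of the random loop model: `Y⁻¹ θ^{|ℒ(ω)|} dρ_u(ω)`. -/
noncomputable def loopMeasure (u β θ : ℝ) : Measure (Config G) :=
  (partitionFunction G u β θ)⁻¹ •
    (rho G u β).withDensity fun ω => ENNReal.ofReal θ ^ ω.numLoops β

end RandomLoops

/-! ### Quantum spin systems

The spin is `S = n / 2`.  The space `⨂_{x ∈ Λ} ℂ^{2S+1}` has the orthonormal basis `|σ⟩`,
`σ : Λ → {-S, …, S}`, and operators are matrices in that basis.  The index `a : Fin (n + 1)`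
stands for the eigenvalue `a - S` of the third spin operator. -/

namespace QuantumSpin

open Matrix

/-- The third spin operator on `ℂ^{2S+1}`, diagonal with eigenvalues `-S, -S+1, …, S`. -/
noncomputable def spin3 (n : ℕ) : Matrix (Fin (n + 1)) (Fin (n + 1)) ℂ :=
  Matrix.diagonal fun a => (a : ℂ) - (n : ℂ) / 2

/-- `⟨a,b| T |c,d⟩ = δ_{a,d} δ_{b,c}`, i.e. `T |a,b⟩ = |b,a⟩`. -/
def T (n : ℕ) : Matrix (Fin (n + 1) × Fin (n + 1)) (Fin (n + 1) × Fin (n + 1)) ℂ :=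
  fun p q => if p.1 = q.2 ∧ p.2 = q.1 then 1 else 0

/-- `⟨a,b| Q |c,d⟩ = δ_{a,b} δ_{c,d}`. -/
def Q (n : ℕ) : Matrix (Fin (n + 1) × Fin (n + 1)) (Fin (n + 1) × Fin (n + 1)) ℂ :=
  fun p q => if p.1 = p.2 ∧ q.1 = q.2 then 1 else 0

variable {Λ : Type*} [Fintype Λ] [DecidableEq Λ] {n : ℕ}

/-- `A_x = A ⊗ Id_{Λ \ {x}}`. -/
def oneSite (x : Λ) (A : Matrix (Fin (n + 1)) (Fin (n + 1)) ℂ) :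
    Matrix (Λ → Fin (n + 1)) (Λ → Fin (n + 1)) ℂ :=
  fun σ τ => if ∀ z, z ≠ x → σ z = τ z then A (σ x) (τ x) else 0

/-- `A_{xy} = A ⊗ Id_{Λ \ {x,y}}`, for `x ≠ y`. -/
def twoSite (x y : Λ)
    (A : Matrix (Fin (n + 1) × Fin (n + 1)) (Fin (n + 1) × Fin (n + 1)) ℂ) :
    Matrix (Λ → Fin (n + 1)) (Λ → Fin (n + 1)) ℂ :=
  fun σ τ => if ∀ z, z ≠ x → z ≠ y → σ z = τ z then A (σ x, σ y) (τ x, τ y) else 0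

/-- The interaction `u T_{xy} + (1-u) Q_{xy} - 1` of the edge `{x,y}`. -/
noncomputable def interaction (n : ℕ) (u : ℝ) (x y : Λ) :
    Matrix (Λ → Fin (n + 1)) (Λ → Fin (n + 1)) ℂ :=
  (u : ℂ) • twoSite x y (T n) + ((1 - u : ℝ) : ℂ) • twoSite x y (Q n) - 1

theorem interaction_comm (n : ℕ) (u : ℝ) (x y : Λ) :
    interaction n u x y = interaction n u y x := by
  have h : ∀ σ τ : Λ → Fin (n + 1), (∀ z, z ≠ x → z ≠ y → σ z = τ z) ↔
      (∀ z, z ≠ y → z ≠ x → σ z = τ z) := fun σ τ =>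
    ⟨fun h z h1 h2 => h z h2 h1, fun h z h1 h2 => h z h2 h1⟩
  have hT : twoSite x y (T n) = twoSite y x (T n) := by
    ext σ τ
    simp only [twoSite, T, h, and_comm]
  have hQ : twoSite x y (Q n) = twoSite y x (Q n) := by
    ext σ τ
    simp only [twoSite, Q, h, eq_comm]
  rw [interaction, interaction, hT, hQ]

/-- The Hamiltonian `H = - ∑_{{x,y} ∈ ℰ} (u T_{xy} + (1-u) Q_{xy} - 1)`. -/
noncomputable def hamiltonian (G : SimpleGraph Λ) [DecidableRel G.Adj] (n : ℕ) (u : ℝ) :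
    Matrix (Λ → Fin (n + 1)) (Λ → Fin (n + 1)) ℂ :=
  -∑ e ∈ G.edgeFinset, Sym2.lift ⟨interaction n u, interaction_comm n u⟩ e

/-- The Gibbs expectation `⟨A⟩ = Tr (A e^{-βH}) / Tr e^{-βH}`. -/
noncomputable def gibbs (G : SimpleGraph Λ) [DecidableRel G.Adj] (n : ℕ) (u β : ℝ)
    (A : Matrix (Λ → Fin (n + 1)) (Λ → Fin (n + 1)) ℂ) : ℂ :=
  (A * NormedSpace.exp (-((β : ℂ) • hamiltonian G n u))).trace /
    (NormedSpace.exp (-((β : ℂ) • hamiltonian G n u))).trace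

end QuantumSpin

/-- The graph is 2D-like with constant `C`: spheres of radius `k ≥ 1` have at most `C k` vertices.
(For `k ≥ 1`, `G.dist x y = k` implies that `x` and `y` are connected by a path.) -/
def Is2DLike {Λ : Type*} (G : SimpleGraph Λ) (C : ℝ) : Prop :=
  ∀ (x : Λ) (k : ℕ), 1 ≤ k → ({y | G.dist x y = k}.ncard : ℝ) ≤ C * k

/-! Two arguments meet. The first is the loop representation. Up to the factor `e^{-β|ℰ|}`,
expanding `e^{-βH}` in powers of the sum of the operators `u T` and `(1-u) Q` over edges, and each
product along sequences of basis vectors, gives a Poisson integral over transitions of a count of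
time-periodic spin configurations. Crosses carry a spin across an edge and double bars force equal
spins at both ends, so these configurations are exactly the assignments of one spin to each loop.
Hence `Tr e^{-βH} = ∫ θ^{|ℒ|} dρ`. Inserting `f(σ_x) f(σ_y)` with `∑ f = 0` gives zero when `(x,0)`
and `(y,0)` lie on different loops, whose spins are summed independently, and the mean of `f²` times
`θ^{|ℒ|}` when they lie on the same loop. So `⟨f_x f_y⟩ = θ⁻¹ (∑ f²) P(E_{x,y,0})`
(`gibbs_diagonal_mul_diagonal`), and `f(a) = a - S` yields the identity for `S³`.

The second is the Mermin–Wagner argument. Every traceless diagonal `f` sees the same probability, so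
it suffices to bound one correlation, and `D = E_aa - E_bb` with two chosen levels is convenient.
The interaction is invariant under simultaneous real rotations, generated by antisymmetric `J`. With
`J = E_ab - E_ba`, `B = E_ab + E_ba`, `C = ∑ φ_z J_z`, `φ_x = 1`, `φ_y = 0` and `A = B_x D_y`, one
has `[C, A] = 2 D_x D_y`. Bogoliubov's inequality (`bogoliubov`) then bounds `|⟨D_x D_y⟩|²` by a
constant times the expectation of `[[C, H], C*]`, and rotation invariance reduces each edge term to
`(φ_v - φ_w)²` times a bounded local operator (`sq_norm_trace_le_energy`). On a 2D-like graph a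
logarithmic profile has energy of order `1 / log d(x,y)` (`sum_gradSq_logProfile_le`); a square root
gives the decay.

Absence of macroscopic loops follows because, for fixed `R`, the number of sites at distance at most
`R` is bounded independently of the graph, the remaining sites of the component contribute little
each, and other components contribute nothing. -/

namespace QuantumSpin

/-! ### Bogoliubov's inequality for finite matrices -/

section Bogoliubov

open Matrix

variable {ι : Type*} [Fintype ι] [DecidableEq ι]

theorem exp_conjStarAlgAut (U : unitary (Matrix ι ι ℂ)) (X : Matrix ι ι ℂ) :
    NormedSpace.exp (Unitary.conjStarAlgAut ℂ _ U X) =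
      Unitary.conjStarAlgAut ℂ _ U (NormedSpace.exp X) := by
  simpa using Matrix.exp_units_conj (Unitary.toUnits U) X

theorem trace_conjStarAlgAut (U : unitary (Matrix ι ι ℂ)) (X : Matrix ι ι ℂ) :
    (Unitary.conjStarAlgAut ℂ _ U X).trace = X.trace := by
  rw [Unitary.conjStarAlgAut_apply, Matrix.trace_mul_cycle]
  simp

/-- This is `1 - e^{-t} ≤ t` with `t = β|b - a|`, multiplied by the larger exponential. The right
side is symmetrized because the sum of the two weights is what `A A* + A* A` produces in an
eigenbasis. -/
theorem abs_exp_sub_exp_mul_abs_sub_le {β : ℝ} (hβ : 0 ≤ β) (a b : ℝ) :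
    |Real.exp (-(β * a)) - Real.exp (-(β * b))| ≤
      β * (Real.exp (-(β * a)) + Real.exp (-(β * b))) * |b - a| := by
  wlog h : a ≤ b generalizing a b
  · have := this b a (le_of_not_ge h)
    rwa [abs_sub_comm, abs_sub_comm b a, add_comm]
  have h1 : Real.exp (-(β * b)) ≤ Real.exp (-(β * a)) := by
    apply Real.exp_le_exp.2; nlinarith
  rw [abs_of_nonneg (by linarith), abs_of_nonneg (by linarith)]
  have h2 : Real.exp (-(β * b)) = Real.exp (-(β * a)) * Real.exp (-(β * (b - a))) := by
    rw [← Real.exp_add]; ring_nf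
  have h3 := Real.add_one_le_exp (-(β * (b - a)))
  have h4 : 0 ≤ β * (b - a) := mul_nonneg hβ (by linarith)
  have h5 := Real.exp_pos (-(β * a))
  have h6 := Real.exp_pos (-(β * b))
  nlinarith [mul_nonneg h4 h6.le, mul_nonneg h5.le
    (show 0 ≤ Real.exp (-(β * (b - a))) - (1 - β * (b - a)) by linarith)]

/-- Bogoliubov's inequality in a basis of eigenvectors of the Hamiltonian. -/
theorem bogoliubov_diagonal {β : ℝ} (hβ : 0 ≤ β) (d : ι → ℝ) (A C : Matrix ι ι ℂ)
    {E H : Matrix ι ι ℂ} (hH : H = diagonal fun i => (d i : ℂ))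
    (hE : E = diagonal fun i => (Real.exp (-(β * d i)) : ℂ)) :
    ‖((C * A - A * C) * E).trace‖ ^ 2 ≤
      β * ((A * star A + star A * A) * E).trace.re *
        (((C * H - H * C) * star C - star C * (C * H - H * C)) * E).trace.re := by
  set p : ι → ℝ := fun i => Real.exp (-(β * d i)) with hp
  have hp0 : ∀ i, 0 < p i := fun i => Real.exp_pos _
  have tr : ∀ M N : Matrix ι ι ℂ, (M * N * E).trace = ∑ i, ∑ j, M i j * N j i * (p i : ℂ) := by
    intro M N
    simp only [Matrix.trace, diag_apply, hE, mul_diagonal]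
    simp only [Matrix.mul_apply, Finset.sum_mul, hp]
  have e1 : ((C * A - A * C) * E).trace = ∑ i, ∑ j, C i j * A j i * ((p i - p j : ℝ) : ℂ) := by
    rw [sub_mul, trace_sub, tr, tr A, Finset.sum_comm (f := fun i j => A i j * C j i * (p i : ℂ)),
      ← Finset.sum_sub_distrib]
    refine Finset.sum_congr rfl fun i _ => ?_
    rw [← Finset.sum_sub_distrib]
    refine Finset.sum_congr rfl fun j _ => ?_
    push_cast; ring
  have e2 : ((A * star A + star A * A) * E).trace.re =
      ∑ i, ∑ j, ‖A j i‖ ^ 2 * (p i + p j) := by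
    rw [add_mul, trace_add, tr, tr (star A),
      Finset.sum_comm (f := fun i j => A i j * star A j i * (p i : ℂ)),
      ← Finset.sum_add_distrib, ← Complex.ofReal_re (∑ i, ∑ j, ‖A j i‖ ^ 2 * (p i + p j))]
    congr 1
    push_cast
    refine Finset.sum_congr rfl fun i _ => ?_
    rw [← Finset.sum_add_distrib]
    refine Finset.sum_congr rfl fun j _ => ?_
    rw [← Complex.mul_conj', star_apply, RCLike.star_def]
    ring
  have e3 : (((C * H - H * C) * star C - star C * (C * H - H * C)) * E).trace.re =
      ∑ i, ∑ j, ‖C i j‖ ^ 2 * ((p i - p j) * (d j - d i)) := by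
    have a0 : ∀ i j, (C * H - H * C) i j = C i j * ((d j - d i : ℝ) : ℂ) := by
      intro i j
      rw [hH, Matrix.sub_apply, mul_diagonal, diagonal_mul]
      push_cast; ring
    rw [sub_mul, trace_sub, tr, tr (star C),
      Finset.sum_comm (f := fun i j => star C i j * (C * H - H * C) j i * (p i : ℂ)),
      ← Finset.sum_sub_distrib, ← Complex.ofReal_re
      (∑ i, ∑ j, ‖C i j‖ ^ 2 * ((p i - p j) * (d j - d i)))]
    congr 1
    push_cast
    refine Finset.sum_congr rfl fun i _ => ?_
    rw [← Finset.sum_sub_distrib]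
    refine Finset.sum_congr rfl fun j _ => ?_
    rw [a0, ← Complex.mul_conj', star_apply, RCLike.star_def]
    push_cast; ring
  -- Boltzmann weights decrease with the energy, so the terms of the double commutator are
  -- nonnegative and can serve as Cauchy–Schwarz weights.
  have hsign : ∀ i j, (p i - p j) * (d j - d i) = |p i - p j| * |d j - d i| := by
    intro i j
    rw [← abs_mul, abs_of_nonneg]
    rcases le_total (d i) (d j) with h | h
    · exact mul_nonneg (sub_nonneg.2 (Real.exp_le_exp.2 (by nlinarith))) (by linarith)
    · exact mul_nonneg_of_nonpos_of_nonpos (sub_nonpos.2 (Real.exp_le_exp.2 (by nlinarith)))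
        (by linarith)
  rw [e1, e2, e3]
  simp only [← Fintype.sum_prod_type']
  have hn : ‖∑ q : ι × ι, C q.1 q.2 * A q.2 q.1 * ((p q.1 - p q.2 : ℝ) : ℂ)‖ ≤
      ∑ q : ι × ι, ‖C q.1 q.2‖ * ‖A q.2 q.1‖ * |p q.1 - p q.2| := by
    refine (norm_sum_le _ _).trans (le_of_eq ?_)
    refine Finset.sum_congr rfl fun q _ => ?_
    rw [norm_mul, norm_mul, Complex.norm_real, Real.norm_eq_abs]
  refine (pow_le_pow_left₀ (norm_nonneg _) hn 2).trans ?_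
  rw [Finset.mul_sum (a := β)]
  -- Cauchy–Schwarz over pairs of eigenvectors: one factor `|p i - p j|` of the square stays with
  -- `C`, the other is traded for `β (p i + p j) |d j - d i|`.
  refine Finset.sum_sq_le_sum_mul_sum_of_sq_le_mul _ (fun q _ => by
    have := (hp0 q.1).le; have := (hp0 q.2).le; positivity)
    (fun q _ => by rw [hsign]; positivity) (fun q _ => ?_)
  rw [hsign]
  have key := abs_exp_sub_exp_mul_abs_sub_le hβ (d q.1) (d q.2)
  calc (‖C q.1 q.2‖ * ‖A q.2 q.1‖ * |p q.1 - p q.2|) ^ 2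
      = ‖C q.1 q.2‖ ^ 2 * ‖A q.2 q.1‖ ^ 2 * |p q.1 - p q.2| * |p q.1 - p q.2| := by ring
    _ ≤ ‖C q.1 q.2‖ ^ 2 * ‖A q.2 q.1‖ ^ 2 * |p q.1 - p q.2| *
        (β * (p q.1 + p q.2) * |d q.2 - d q.1|) := by gcongr
    _ = _ := by ring

/-- Bogoliubov's inequality, with the Duhamel inner product bounded by `β (A A* + A* A)`. -/
theorem bogoliubov {β : ℝ} (hβ : 0 ≤ β) {H : Matrix ι ι ℂ} (hH : H.IsHermitian)
    (A C : Matrix ι ι ℂ) :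
    ‖((C * A - A * C) * NormedSpace.exp (-((β : ℂ) • H))).trace‖ ^ 2 ≤
      β * ((A * star A + star A * A) * NormedSpace.exp (-((β : ℂ) • H))).trace.re *
        (((C * H - H * C) * star C - star C * (C * H - H * C)) *
          NormedSpace.exp (-((β : ℂ) • H))).trace.re := by
  obtain ⟨U, d, rfl⟩ : ∃ (U : unitary (Matrix ι ι ℂ)) (d : ι → ℝ),
      H = Unitary.conjStarAlgAut ℂ _ U (diagonal fun i => (d i : ℂ)) :=
    ⟨_, _, hH.spectral_theorem⟩
  set ψ := Unitary.conjStarAlgAut ℂ (Matrix ι ι ℂ) U with hψ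
  have h2 : NormedSpace.exp (-((β : ℂ) • ψ (diagonal fun i => (d i : ℂ)))) =
      ψ (diagonal fun i => (Real.exp (-(β * d i)) : ℂ)) := by
    rw [← map_smul, ← map_neg, hψ, exp_conjStarAlgAut, ← diagonal_smul, diagonal_neg,
      Matrix.exp_diagonal]
    congr 2
    ext i
    simp [Pi.coe_exp, Complex.exp_eq_exp_ℂ]
  rw [h2]
  obtain ⟨A', rfl⟩ : ∃ A', ψ A' = A := ψ.surjective A
  obtain ⟨C', rfl⟩ : ∃ C', ψ C' = C := ψ.surjective C
  have := bogoliubov_diagonal hβ d A' C' rfl rfl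
  simpa only [← map_mul, ← map_sub, ← map_add, ← map_star, hψ, trace_conjStarAlgAut] using this

end Bogoliubov

/-! ### Gibbs traces bounded by row sums -/

section TraceBound

open Matrix

attribute [local instance] Matrix.linftyOpNormedAddCommGroup Matrix.linftyOpNormedSpace
  Matrix.linftyOpNormedRing Matrix.linftyOpNormedAlgebra

variable {ι : Type*} [Fintype ι] [DecidableEq ι]

theorem row_sum_le_norm (X : Matrix ι ι ℂ) (i : ι) : ∑ j, ‖X i j‖ ≤ ‖X‖ := by
  rw [Matrix.linfty_opNorm_def]
  have := Finset.le_sup (f := fun i => ∑ j, ‖X i j‖₊) (Finset.mem_univ i)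
  calc ∑ j, ‖X i j‖ = ((∑ j, ‖X i j‖₊ : NNReal) : ℝ) := by push_cast; rfl
    _ ≤ _ := by exact_mod_cast this

omit [DecidableEq ι] in
theorem norm_le_of_row_sum_le {κ : Type*} [Fintype κ] (X : Matrix ι κ ℂ) {R : ℝ} (hR : 0 ≤ R)
    (h : ∀ i, ∑ j, ‖X i j‖ ≤ R) : ‖X‖ ≤ R := by
  rw [Matrix.linfty_opNorm_def]
  lift R to NNReal using hR
  norm_cast
  refine Finset.sup_le fun i _ => ?_
  have := h i
  rw [← NNReal.coe_le_coe]
  push_cast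
  exact this

/-- The Schur test for a quadratic form. -/
theorem norm_trace_mul_mul_self_le {B : Matrix ι ι ℂ} (hB : B.IsHermitian) (X : Matrix ι ι ℂ)
    {R : ℝ} (h1 : ‖X‖ ≤ R) (h2 : ‖star X‖ ≤ R) :
    ‖(X * (B * B)).trace‖ ≤ R * (B * B).trace.re := by
  have hb : ∀ i j, ‖B i j‖ = ‖B j i‖ := fun i j => by
    rw [← hB.apply i j, norm_star]
  have t0 : (B * B).trace.re = ∑ k, ∑ i, ‖B i k‖ ^ 2 := by
    rw [Finset.sum_comm]
    have : (B * B).trace = ((∑ i, ∑ k, ‖B i k‖ ^ 2 : ℝ) : ℂ) := by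
      push_cast
      simp only [Matrix.trace, diag_apply, Matrix.mul_apply]
      refine Finset.sum_congr rfl fun i _ => Finset.sum_congr rfl fun k _ => ?_
      rw [← Complex.mul_conj', ← hB.apply k i]
      rfl
    rw [this, Complex.ofReal_re]
  have t1 : (X * (B * B)).trace = ∑ k, ∑ i, ∑ j, X i j * (B j k * B k i) := by
    simp only [Matrix.trace, diag_apply, Matrix.mul_apply, Finset.mul_sum]
    rw [Finset.sum_comm (s := Finset.univ (α := ι)) (f := fun k i => ∑ j, X i j * (B j k * B k i))]
    refine Finset.sum_congr rfl fun i _ => Finset.sum_comm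
  rw [t1, t0, Finset.mul_sum]
  refine (norm_sum_le _ _).trans (Finset.sum_le_sum fun k _ => ?_)
  have b1 : ‖∑ i, ∑ j, X i j * (B j k * B k i)‖ ≤
      ∑ i, ∑ j, (‖X i j‖ * ‖B i k‖ ^ 2 / 2 + ‖X i j‖ * ‖B j k‖ ^ 2 / 2) := by
    refine (norm_sum_le _ _).trans (Finset.sum_le_sum fun i _ => ?_)
    refine (norm_sum_le _ _).trans (Finset.sum_le_sum fun j _ => ?_)
    rw [norm_mul, norm_mul, hb k i]
    -- By `2ab ≤ a² + b²` the form splits into two halves, one controlled by the row sums of `X` and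
    -- the other by its column sums. The latter explains the separate hypothesis on `star X`, as the
    -- row-sum norm is not invariant under adjoints.
    nlinarith [mul_nonneg (norm_nonneg (X i j)) (sq_nonneg (‖B i k‖ - ‖B j k‖))]
  refine b1.trans ?_
  simp only [Finset.sum_add_distrib]
  have b2 : ∑ i, ∑ j, ‖X i j‖ * ‖B i k‖ ^ 2 / 2 ≤ ∑ i, R * ‖B i k‖ ^ 2 / 2 := by
    refine Finset.sum_le_sum fun i _ => ?_
    rw [← Finset.sum_div, ← Finset.sum_mul]
    have := (row_sum_le_norm X i).trans h1
    gcongr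
  have b3 : ∑ i, ∑ j, ‖X i j‖ * ‖B j k‖ ^ 2 / 2 ≤ ∑ i, R * ‖B i k‖ ^ 2 / 2 := by
    rw [Finset.sum_comm]
    refine Finset.sum_le_sum fun i _ => ?_
    rw [← Finset.sum_div, ← Finset.sum_mul]
    have := (row_sum_le_norm (star X) i).trans h2
    simp only [star_apply, norm_star] at this
    gcongr
  refine (add_le_add b2 b3).trans (le_of_eq ?_)
  rw [← Finset.sum_add_distrib, Finset.mul_sum]
  refine Finset.sum_congr rfl fun i _ => by ring

theorem exp_eq_mul_self (K : Matrix ι ι ℂ) : NormedSpace.exp K =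
    NormedSpace.exp ((1 / 2 : ℝ) • K) * NormedSpace.exp ((1 / 2 : ℝ) • K) := by
  rw [← Matrix.exp_add_of_commute _ _ (Commute.refl _), ← add_smul]
  norm_num

theorem _root_.Matrix.IsHermitian.exp_half {K : Matrix ι ι ℂ} (hK : K.IsHermitian) :
    (NormedSpace.exp ((1 / 2 : ℝ) • K)).IsHermitian := by
  apply IsHermitian.exp
  rw [IsHermitian, conjTranspose_smul, hK.eq]; simp

open scoped ComplexOrder in
theorem trace_star_mul_self_mul_exp_nonneg {K : Matrix ι ι ℂ} (hK : K.IsHermitian)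
    (X : Matrix ι ι ℂ) : 0 ≤ (star X * X * NormedSpace.exp K).trace.re := by
  have h := (posSemidef_conjTranspose_mul_self
    (X * NormedSpace.exp ((1 / 2 : ℝ) • K))).trace_nonneg
  rw [conjTranspose_mul, hK.exp_half.eq, trace_mul_comm] at h
  rw [exp_eq_mul_self, star_eq_conjTranspose, mul_assoc, trace_mul_comm]
  simp only [mul_assoc] at h ⊢
  exact (Complex.le_def.1 h).1

/-- Writing `e^K` as the square of the Hermitian matrix `e^{K/2}` turns the trace into a quadratic
form, to which the Schur test applies. Row sums are used because those of local operators do not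
grow with the volume. -/
theorem norm_trace_mul_exp_le {K : Matrix ι ι ℂ} (hK : K.IsHermitian) (X : Matrix ι ι ℂ)
    {R : ℝ} (h1 : ‖X‖ ≤ R) (h2 : ‖star X‖ ≤ R) :
    ‖(X * NormedSpace.exp K).trace‖ ≤ R * (NormedSpace.exp K).trace.re := by
  rw [exp_eq_mul_self]
  exact norm_trace_mul_mul_self_le hK.exp_half X h1 h2

end TraceBound

end QuantumSpin

namespace QuantumSpin

/-! ### Algebra of one-site and two-site operators, and rotation invariance -/

section Operators

open Matrix
open scoped Kronecker

variable {Λ : Type*} [Fintype Λ] [DecidableEq Λ] {n : ℕ}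

/-- A configuration agreeing with `σ` off `x` is determined by its value at `x`. This reduces
products and row sums of local operators to those of small matrices. -/
theorem sum_ite_agree_off_one {M : Type*} [AddCommMonoid M] (x : Λ) (σ : Λ → Fin (n + 1))
    (F : (Λ → Fin (n + 1)) → M) :
    ∑ ρ, (if ∀ z, z ≠ x → σ z = ρ z then F ρ else 0) = ∑ a, F (Function.update σ x a) := by
  rw [← Finset.sum_filter]
  refine Finset.sum_nbij' (fun ρ => ρ x) (fun a => Function.update σ x a) (by simp) ?_ ?_
    (by simp) ?_
  · intro a _
    simp only [Finset.mem_filter, Finset.mem_univ, true_and]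
    intro z hz
    simp [hz]
  · intro ρ hρ
    simp only [Finset.mem_filter, Finset.mem_univ, true_and] at hρ
    ext1 z
    by_cases hz : z = x
    · simp [hz]
    · simp [hz, hρ z hz]
  · intro ρ hρ
    simp only [Finset.mem_filter, Finset.mem_univ, true_and] at hρ
    congr 1
    ext1 z
    by_cases hz : z = x
    · simp [hz]
    · simp [hz, hρ z hz]

theorem sum_ite_agree_off_two {M : Type*} [AddCommMonoid M] {x y : Λ} (hxy : x ≠ y)
    (σ : Λ → Fin (n + 1)) (F : (Λ → Fin (n + 1)) → M) :
    ∑ ρ, (if ∀ z, z ≠ x → z ≠ y → σ z = ρ z then F ρ else 0) =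
      ∑ p : Fin (n + 1) × Fin (n + 1), F (Function.update (Function.update σ x p.1) y p.2) := by
  have key : ∀ ρ : Λ → Fin (n + 1), (∀ z, z ≠ x → z ≠ y → σ z = ρ z) →
      Function.update (Function.update σ x (ρ x)) y (ρ y) = ρ := by
    intro ρ hρ
    ext1 z
    by_cases hz : z = y
    · subst hz; simp
    · by_cases hz' : z = x
      · subst hz'; simp [hxy]
      · simp [hz, hz', hρ z hz' hz]
  rw [← Finset.sum_filter]
  refine Finset.sum_nbij' (fun ρ => (ρ x, ρ y))
    (fun p => Function.update (Function.update σ x p.1) y p.2) (by simp) ?_ ?_ ?_ ?_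
  · intro a _
    simp only [Finset.mem_filter, Finset.mem_univ, true_and]
    intro z hz hz'
    simp [hz, hz']
  · intro ρ hρ
    simp only [Finset.mem_filter, Finset.mem_univ, true_and] at hρ
    exact key ρ hρ
  · rintro ⟨a, b⟩ _
    simp [hxy]
  · intro ρ hρ
    simp only [Finset.mem_filter, Finset.mem_univ, true_and] at hρ
    simp only [key ρ hρ]

theorem twoSite_mul {x y : Λ} (hxy : x ≠ y)
    (A B : Matrix (Fin (n + 1) × Fin (n + 1)) (Fin (n + 1) × Fin (n + 1)) ℂ) :
    twoSite x y A * twoSite x y B = twoSite x y (A * B) := by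
  ext σ τ
  simp only [Matrix.mul_apply, twoSite, ite_mul, zero_mul]
  rw [sum_ite_agree_off_two hxy]
  by_cases h : ∀ z, z ≠ x → z ≠ y → σ z = τ z
  · rw [if_pos h]
    refine Finset.sum_congr rfl fun p _ => ?_
    rw [if_pos]
    · simp [hxy]
    · intro z hz hz'
      simpa [hz, hz'] using h z hz hz'
  · rw [if_neg h]
    refine Finset.sum_eq_zero fun p _ => ?_
    rw [if_neg, mul_zero]
    contrapose! h
    intro z hz hz'
    simpa [hz, hz'] using h z hz hz'

theorem oneSite_eq_twoSite_left {x y : Λ} (hxy : x ≠ y)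
    (A : Matrix (Fin (n + 1)) (Fin (n + 1)) ℂ) :
    oneSite x A = twoSite x y (A ⊗ₖ (1 : Matrix (Fin (n + 1)) (Fin (n + 1)) ℂ)) := by
  ext σ τ
  simp only [oneSite, twoSite, kronecker_apply, Matrix.one_apply]
  by_cases h : ∀ z, z ≠ x → σ z = τ z
  · rw [if_pos h, if_pos fun z hz _ => h z hz, if_pos (h y hxy.symm), mul_one]
  · rw [if_neg h]
    split_ifs with h1 h2
    · refine absurd (fun z hz => ?_) h
      by_cases hz' : z = y
      · rw [hz', h2]
      · exact h1 z hz hz'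
    · simp
    · rfl

theorem twoSite_swap (x y : Λ)
    (A : Matrix (Fin (n + 1) × Fin (n + 1)) (Fin (n + 1) × Fin (n + 1)) ℂ) :
    twoSite x y A = twoSite y x (A.submatrix Prod.swap Prod.swap) := by
  ext σ τ
  simp only [twoSite, submatrix_apply, Prod.swap_prod_mk]
  congr 1
  exact propext ⟨fun h z h1 h2 => h z h2 h1, fun h z h1 h2 => h z h2 h1⟩

theorem oneSite_eq_twoSite_right {x y : Λ} (hxy : x ≠ y)
    (A : Matrix (Fin (n + 1)) (Fin (n + 1)) ℂ) :
    oneSite y A = twoSite x y ((1 : Matrix (Fin (n + 1)) (Fin (n + 1)) ℂ) ⊗ₖ A) := by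
  rw [oneSite_eq_twoSite_left hxy.symm, twoSite_swap]
  congr 1
  ext ⟨a, b⟩ ⟨c, d⟩
  simp [mul_comm]

theorem oneSite_mul (x : Λ) (A B : Matrix (Fin (n + 1)) (Fin (n + 1)) ℂ) :
    oneSite x A * oneSite x B = oneSite x (A * B) := by
  ext σ τ
  simp only [Matrix.mul_apply, oneSite, ite_mul, zero_mul]
  rw [sum_ite_agree_off_one]
  by_cases h : ∀ z, z ≠ x → σ z = τ z
  · rw [if_pos h]
    refine Finset.sum_congr rfl fun p _ => ?_
    rw [if_pos]
    · simp
    · intro z hz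
      simpa [hz] using h z hz
  · rw [if_neg h]
    refine Finset.sum_eq_zero fun p _ => ?_
    rw [if_neg, mul_zero]
    contrapose! h
    intro z hz
    simpa [hz] using h z hz

theorem commute_oneSite {x y : Λ} (hxy : x ≠ y) (A B : Matrix (Fin (n + 1)) (Fin (n + 1)) ℂ) :
    Commute (oneSite x A) (oneSite y B) := by
  rw [Commute, SemiconjBy, oneSite_eq_twoSite_left hxy, oneSite_eq_twoSite_right hxy,
    twoSite_mul hxy, twoSite_mul hxy, ← mul_kronecker_mul, ← mul_kronecker_mul]
  simp

theorem commute_oneSite_twoSite {x y z : Λ} (hxy : x ≠ y) (hzx : z ≠ x) (hzy : z ≠ y)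
    (A : Matrix (Fin (n + 1)) (Fin (n + 1)) ℂ)
    (B : Matrix (Fin (n + 1) × Fin (n + 1)) (Fin (n + 1) × Fin (n + 1)) ℂ) :
    Commute (oneSite z A) (twoSite x y B) := by
  ext σ τ
  simp only [Matrix.mul_apply, oneSite, twoSite, ite_mul, zero_mul]
  rw [sum_ite_agree_off_one, sum_ite_agree_off_two hxy]
  have l : ∀ a, (∀ w, w ≠ x → w ≠ y → Function.update σ z a w = τ w) ↔
      a = τ z ∧ ∀ w, w ≠ x → w ≠ y → w ≠ z → σ w = τ w := by
    intro a
    constructor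
    · intro h
      refine ⟨by simpa using h z hzx hzy, fun w h1 h2 h3 => by simpa [h3] using h w h1 h2⟩
    · rintro ⟨h1, h2⟩ w hx hy
      by_cases hw : w = z
      · subst hw; simp [h1]
      · simpa [hw] using h2 w hx hy hw
  have r : ∀ p : Fin (n + 1) × Fin (n + 1),
      (∀ w, w ≠ z → Function.update (Function.update σ x p.1) y p.2 w = τ w) ↔
      p = (τ x, τ y) ∧ ∀ w, w ≠ x → w ≠ y → w ≠ z → σ w = τ w := by
    rintro ⟨a, b⟩
    constructor
    · intro h
      refine ⟨Prod.ext ?_ ?_, fun w h1 h2 h3 => by simpa [h1, h2] using h w h3⟩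
      · simpa [hxy] using h x hzx.symm
      · simpa using h y hzy.symm
    · rintro ⟨h1, h2⟩ w hw
      simp only [Prod.mk.injEq] at h1
      by_cases hy : w = y
      · subst hy; simp [h1]
      · by_cases hx : w = x
        · subst hx; simp [hy, h1]
        · simpa [hx, hy] using h2 w hx hy hw
  simp only [l, r]
  by_cases h : ∀ w, w ≠ x → w ≠ y → w ≠ z → σ w = τ w
  · simp only [eq_true h, and_true, Finset.sum_ite_eq', Finset.mem_univ, if_true, hzx.symm,
      hzy.symm, hzx, hzy, hxy, ne_eq, not_false_eq_true, Function.update_of_ne,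
      Function.update_self, mul_ite, mul_zero, zero_mul, mul_comm]
  · simp [eq_false h]

theorem oneSite_sub (x : Λ) (A B : Matrix (Fin (n + 1)) (Fin (n + 1)) ℂ) :
    oneSite x (A - B) = oneSite x A - oneSite x B := by
  ext σ τ; simp only [oneSite, Matrix.sub_apply]; split_ifs <;> simp

theorem oneSite_smul (x : Λ) (c : ℂ) (A : Matrix (Fin (n + 1)) (Fin (n + 1)) ℂ) :
    oneSite x (c • A) = c • oneSite x A := by
  ext σ τ; simp only [oneSite, Matrix.smul_apply]; split_ifs <;> simp

theorem star_oneSite (x : Λ) (A : Matrix (Fin (n + 1)) (Fin (n + 1)) ℂ) :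
    star (oneSite x A) = oneSite x (star A) := by
  ext σ τ; simp only [oneSite, star_apply, apply_ite star, star_zero, eq_comm]

theorem twoSite_add (x y : Λ)
    (A B : Matrix (Fin (n + 1) × Fin (n + 1)) (Fin (n + 1) × Fin (n + 1)) ℂ) :
    twoSite x y (A + B) = twoSite x y A + twoSite x y B := by
  ext σ τ; simp only [twoSite, Matrix.add_apply]; split_ifs <;> simp

theorem star_twoSite (x y : Λ)
    (A : Matrix (Fin (n + 1) × Fin (n + 1)) (Fin (n + 1) × Fin (n + 1)) ℂ) :
    star (twoSite x y A) = twoSite x y (star A) := by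
  ext σ τ; simp only [twoSite, star_apply, apply_ite star, star_zero, eq_comm]

theorem star_T : star (T n) = T n := by
  ext p q; simp [T, star_apply, eq_comm, and_comm]

theorem star_Q : star (Q n) = Q n := by
  ext p q; simp [Q, star_apply, and_comm]

theorem star_interaction (u : ℝ) (x y : Λ) : star (interaction n u x y) = interaction n u x y := by
  simp [interaction, star_twoSite, star_T, star_Q]

/-- `T` exchanges the two tensor factors, and the generator is symmetric in them. -/
theorem T_commute (J : Matrix (Fin (n + 1)) (Fin (n + 1)) ℂ) :
    Commute (J ⊗ₖ (1 : Matrix (Fin (n + 1)) (Fin (n + 1)) ℂ) + 1 ⊗ₖ J) (T n) := by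
  ext ⟨a, b⟩ ⟨c, d⟩
  simp only [Matrix.mul_apply, Fintype.sum_prod_type, T, Matrix.add_apply, kronecker_apply,
    Matrix.one_apply]
  simp [ite_and, Finset.sum_ite_eq, add_comm, mul_comm, eq_comm]

/-- `Q` is a rank-one matrix built on `∑ |a,a⟩`. The generator sends this vector to `∑ (J a b + J b
a) |a,b⟩`, which vanishes by antisymmetry, so both products with `Q` are zero. -/
theorem Q_commute {J : Matrix (Fin (n + 1)) (Fin (n + 1)) ℂ} (hJ : Jᵀ = -J) :
    Commute (J ⊗ₖ (1 : Matrix (Fin (n + 1)) (Fin (n + 1)) ℂ) + 1 ⊗ₖ J) (Q n) := by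
  have h : ∀ a b, J a b = - J b a := fun a b => by
    rw [← Matrix.neg_apply, ← hJ, transpose_apply]
  have l : (J ⊗ₖ (1 : Matrix (Fin (n + 1)) (Fin (n + 1)) ℂ) + 1 ⊗ₖ J) * Q n = 0 := by
    ext ⟨a, b⟩ ⟨c, d⟩
    simp only [Matrix.mul_apply, Fintype.sum_prod_type, Q, Matrix.add_apply, kronecker_apply,
      Matrix.one_apply, Matrix.zero_apply]
    by_cases hcd : c = d
    · simp [hcd]
      simp [Finset.sum_add_distrib, h b a]
    · simp [hcd]
  have r : Q n * (J ⊗ₖ (1 : Matrix (Fin (n + 1)) (Fin (n + 1)) ℂ) + 1 ⊗ₖ J) = 0 := by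
    ext ⟨a, b⟩ ⟨c, d⟩
    simp only [Matrix.mul_apply, Fintype.sum_prod_type, Q, Matrix.add_apply, kronecker_apply,
      Matrix.one_apply, Matrix.zero_apply]
    by_cases hab : a = b
    · simp [hab]
      simp [Finset.sum_add_distrib, h d c]
    · simp [hab]
  rw [Commute, SemiconjBy, l, r]

theorem commute_interaction_of_ne (u : ℝ) {x y z : Λ} (hxy : x ≠ y) (hzx : z ≠ x) (hzy : z ≠ y)
    (A : Matrix (Fin (n + 1)) (Fin (n + 1)) ℂ) :
    Commute (oneSite z A) (interaction n u x y) :=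
  (((commute_oneSite_twoSite hxy hzx hzy A _).smul_right _).add_right
    ((commute_oneSite_twoSite hxy hzx hzy A _).smul_right _)).sub_right (Commute.one_right _)

theorem commute_twoSite {x y : Λ} (hxy : x ≠ y)
    {A B : Matrix (Fin (n + 1) × Fin (n + 1)) (Fin (n + 1) × Fin (n + 1)) ℂ} (h : Commute A B) :
    Commute (twoSite x y A) (twoSite x y B) := by
  rw [Commute, SemiconjBy, twoSite_mul hxy, twoSite_mul hxy, h.eq]

theorem commute_interaction (u : ℝ) {x y : Λ} (hxy : x ≠ y)
    {J : Matrix (Fin (n + 1)) (Fin (n + 1)) ℂ} (hJ : Jᵀ = -J) :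
    Commute (oneSite x J + oneSite y J) (interaction n u x y) := by
  rw [oneSite_eq_twoSite_left hxy, oneSite_eq_twoSite_right hxy, ← twoSite_add]
  exact (((commute_twoSite hxy (T_commute J)).smul_right _).add_right
    ((commute_twoSite hxy (Q_commute hJ)).smul_right _)).sub_right (Commute.one_right _)

/-- The generator of the inhomogeneous rotation with angles `φ`. -/
noncomputable def rotationGenerator (φ : Λ → ℝ) (J : Matrix (Fin (n + 1)) (Fin (n + 1)) ℂ) :
    Matrix (Λ → Fin (n + 1)) (Λ → Fin (n + 1)) ℂ :=
  ∑ z, (φ z : ℂ) • oneSite z J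

/-- Subtracting the rotation that turns both ends of the edge by `φ x` does not affect the
commutator with the interaction. What is left at `y` is a rotation by `φ y - φ x`, and it enters
twice, hence the square. -/
theorem double_commutator_interaction (u : ℝ) {x y : Λ} (hxy : x ≠ y)
    {J : Matrix (Fin (n + 1)) (Fin (n + 1)) ℂ} (hJ : Jᵀ = -J) (φ : Λ → ℝ) :
    let C := rotationGenerator φ J
    let h := interaction n u x y
    let K := oneSite y J
    (C * h - h * C) * C - C * (C * h - h * C) =
      (((φ x - φ y) ^ 2 : ℝ) : ℂ) • ((K * h - h * K) * K - K * (K * h - h * K)) := by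
  intro C h K
  -- The part of the generator that commutes with both the interaction on the edge and `K`.
  set D := (φ x : ℂ) • (oneSite x J + K) +
    ∑ z ∈ (Finset.univ.erase x).erase y, (φ z : ℂ) • oneSite z J
    with hD
  have hC : C = D + ((φ y - φ x : ℝ) : ℂ) • K := by
    have e1 := Finset.add_sum_erase Finset.univ (fun z => (φ z : ℂ) • oneSite z J)
      (Finset.mem_univ x)
    have e2 := Finset.add_sum_erase (Finset.univ.erase x) (fun z => (φ z : ℂ) • oneSite z J)
      (Finset.mem_erase.2 ⟨hxy.symm, Finset.mem_univ y⟩)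
    simp only [C, rotationGenerator, ← e1, ← e2, hD]
    push_cast
    module
  have hDh : Commute D h := by
    refine Commute.add_left ((commute_interaction u hxy hJ).smul_left _) ?_
    refine Commute.sum_left _ _ _ fun z hz => ?_
    simp only [Finset.mem_erase, Finset.mem_univ, and_true] at hz
    exact (commute_interaction_of_ne u hxy hz.2 hz.1 J).smul_left _
  have hDK : Commute D K := by
    refine Commute.add_left (((commute_oneSite hxy J J).add_left (Commute.refl _)).smul_left _) ?_
    refine Commute.sum_left _ _ _ fun z hz => ?_
    simp only [Finset.mem_erase, Finset.mem_univ, and_true] at hz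
    exact (commute_oneSite hz.1 J J).smul_left _
  have c1 : C * h - h * C = ((φ y - φ x : ℝ) : ℂ) • (K * h - h * K) := by
    rw [hC, add_mul, mul_add, hDh.eq, smul_mul_assoc, mul_smul_comm]
    module
  have c2 : Commute D (K * h - h * K) :=
    (hDK.mul_right hDh).sub_right (hDh.mul_right hDK)
  rw [c1, hC, mul_add, add_mul, mul_smul_comm _ D, c2.eq]
  simp only [smul_mul_assoc, mul_smul_comm, smul_smul]
  push_cast
  module

end Operators

end QuantumSpin

namespace QuantumSpin

/-! ### The Mermin–Wagner estimate -/

section MerminWagner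

open Matrix

attribute [local instance] Matrix.linftyOpNormedAddCommGroup Matrix.linftyOpNormedSpace
  Matrix.linftyOpNormedRing Matrix.linftyOpNormedAlgebra

variable {Λ : Type*} [Fintype Λ] [DecidableEq Λ] {n : ℕ}

/-- Each row of `A ⊗ Id` has the nonzero entries of a row of `A`, so the volume does not enter. -/
theorem norm_oneSite_le (x : Λ) (A : Matrix (Fin (n + 1)) (Fin (n + 1)) ℂ) :
    ‖oneSite x A‖ ≤ ‖A‖ := by
  refine norm_le_of_row_sum_le _ (norm_nonneg _) fun σ => ?_
  simp only [oneSite, apply_ite norm, norm_zero]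
  rw [sum_ite_agree_off_one]
  simpa using row_sum_le_norm A (σ x)

theorem norm_twoSite_le {x y : Λ} (hxy : x ≠ y)
    (A : Matrix (Fin (n + 1) × Fin (n + 1)) (Fin (n + 1) × Fin (n + 1)) ℂ) :
    ‖twoSite x y A‖ ≤ ‖A‖ := by
  refine norm_le_of_row_sum_le _ (norm_nonneg _) fun σ => ?_
  simp only [twoSite, apply_ite norm, norm_zero]
  rw [sum_ite_agree_off_two hxy]
  simpa [hxy] using row_sum_le_norm A (σ x, σ y)

theorem norm_T_le : ‖T n‖ ≤ 1 := by
  refine norm_le_of_row_sum_le _ zero_le_one fun p => ?_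
  simp [T, apply_ite norm, Fintype.sum_prod_type, ite_and]

theorem norm_Q_le : ‖Q n‖ ≤ n + 1 := by
  refine norm_le_of_row_sum_le _ (by positivity) fun p => ?_
  by_cases h : p.1 = p.2
  · simp only [Q, h, true_and, apply_ite norm, norm_one, norm_zero, Fintype.sum_prod_type]
    simp
  · simp only [Q, h, false_and, if_false, norm_zero, Finset.sum_const_zero]
    positivity

theorem norm_interaction_le {u : ℝ} (hu : u ∈ Icc (0 : ℝ) 1) {x y : Λ} (hxy : x ≠ y) :
    ‖interaction n u x y‖ ≤ n + 3 := by
  have h1 : ‖(1 : Matrix (Λ → Fin (n + 1)) (Λ → Fin (n + 1)) ℂ)‖ ≤ 1 := by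
    refine norm_le_of_row_sum_le _ zero_le_one fun p => ?_
    simp [Matrix.one_apply, apply_ite norm]
  have h2 : ‖(u : ℂ) • twoSite x y (T n)‖ ≤ 1 := by
    rw [norm_smul, Complex.norm_real, Real.norm_eq_abs, abs_of_nonneg hu.1]
    exact mul_le_one₀ hu.2 (norm_nonneg _) ((norm_twoSite_le hxy _).trans norm_T_le)
  have h3 : ‖((1 - u : ℝ) : ℂ) • twoSite x y (Q n)‖ ≤ n + 1 := by
    rw [norm_smul, Complex.norm_real, Real.norm_eq_abs, abs_of_nonneg (sub_nonneg.2 hu.2)]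
    calc _ ≤ 1 * ((n : ℝ) + 1) := mul_le_mul (by linarith [hu.1])
          ((norm_twoSite_le hxy _).trans norm_Q_le) (norm_nonneg _) zero_le_one
      _ = _ := one_mul _
  refine (norm_sub_le _ _).trans ?_
  linarith [norm_add_le ((u : ℂ) • twoSite x y (T n)) (((1 - u : ℝ) : ℂ) • twoSite x y (Q n))]

theorem norm_single_le (a b : Fin (n + 1)) : ‖(Matrix.single a b (1 : ℂ))‖ ≤ 1 := by
  refine norm_le_of_row_sum_le _ zero_le_one fun p => ?_
  by_cases h : a = p <;> simp [Matrix.single_apply, h, apply_ite norm]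

/-- The squared increment of a function on the vertices along an edge. -/
noncomputable def gradSq (φ : Λ → ℝ) : Sym2 Λ → ℝ :=
  Sym2.lift ⟨fun x y => (φ x - φ y) ^ 2, fun x y => by ring⟩

omit [Fintype Λ] [DecidableEq Λ] in
theorem gradSq_nonneg (φ : Λ → ℝ) (e : Sym2 Λ) : 0 ≤ gradSq φ e := by
  induction e with
  | _ x y => exact sq_nonneg (φ x - φ y)

theorem isHermitian_hamiltonian (G : SimpleGraph Λ) [DecidableRel G.Adj] (u : ℝ) :
    (hamiltonian G n u).IsHermitian := by
  unfold hamiltonian Matrix.IsHermitian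
  rw [← star_eq_conjTranspose, star_neg, star_sum]
  congr 1
  refine Finset.sum_congr rfl fun e _ => ?_
  induction e with
  | _ x y => exact star_interaction u x y

theorem norm_double_commutator_le {R : Type*} [NormedRing R] (K h : R) :
    ‖(K * h - h * K) * K - K * (K * h - h * K)‖ ≤ 4 * ‖K‖ ^ 2 * ‖h‖ := by
  have h1 : ‖K * h - h * K‖ ≤ 2 * (‖K‖ * ‖h‖) := by
    refine (norm_sub_le _ _).trans ?_
    linarith [norm_mul_le K h, norm_mul_le h K]
  refine (norm_sub_le _ _).trans ?_
  have h2 := (norm_mul_le (K * h - h * K) K).trans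
    (mul_le_mul_of_nonneg_right h1 (norm_nonneg K))
  have h3 := (norm_mul_le K (K * h - h * K)).trans
    (mul_le_mul_of_nonneg_left h1 (norm_nonneg K))
  nlinarith

/-- Correlations are controlled by the gradient energy of any function that interpolates between
the two sites. -/
theorem sq_norm_trace_le_energy {u β : ℝ} (hu : u ∈ Icc (0 : ℝ) 1) (hβ : 0 ≤ β)
    (G : SimpleGraph Λ) [DecidableRel G.Adj] {x y : Λ} (hxy : x ≠ y) {φ : Λ → ℝ} (hx : φ x = 1)
    (hy : φ y = 0) {a b : Fin (n + 1)} (hab : a ≠ b) :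
    let D : Matrix (Fin (n + 1)) (Fin (n + 1)) ℂ := Matrix.single a a 1 - Matrix.single b b 1
    ‖(oneSite x D * oneSite y D * NormedSpace.exp (-((β : ℂ) • hamiltonian G n u))).trace‖ ^ 2 ≤
      128 * β * (n + 3) * (∑ e ∈ G.edgeFinset, gradSq φ e) *
        (NormedSpace.exp (-((β : ℂ) • hamiltonian G n u))).trace.re ^ 2 := by
  intro D
  set H := hamiltonian G n u with hH
  set E := NormedSpace.exp (-((β : ℂ) • H)) with hE
  set J : Matrix (Fin (n + 1)) (Fin (n + 1)) ℂ := Matrix.single a b 1 - Matrix.single b a 1 with hJ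
  set B : Matrix (Fin (n + 1)) (Fin (n + 1)) ℂ := Matrix.single a b 1 + Matrix.single b a 1 with hB
  have hJt : Jᵀ = -J := by simp [hJ]
  have hJs : star J = -J := by simp [hJ, star_eq_conjTranspose]
  have hBs : star B = B := by simp [hB, star_eq_conjTranspose, add_comm]
  have hDs : star D = D := by simp [D, star_eq_conjTranspose]
  have hJn : ‖J‖ ≤ 2 := (norm_sub_le _ _).trans (by
    linarith [norm_single_le a b, norm_single_le b a])
  have hBn : ‖B‖ ≤ 2 := (norm_add_le _ _).trans (by
    linarith [norm_single_le a b, norm_single_le b a])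
  have hDn : ‖D‖ ≤ 2 := (norm_sub_le _ _).trans (by
    linarith [norm_single_le a a, norm_single_le b b])
  -- Inside the two levels `a`, `b`, the rotation generated by `J` moves `B` towards `D`. This is
  -- how a derivative along a symmetry produces the diagonal observable.
  have hJB : J * B - B * J = (2 : ℂ) • D := by
    simp only [hJ, hB, D, mul_add, sub_mul, mul_sub, add_mul, Matrix.single_mul_single_same,
      Matrix.single_mul_single_of_ne, hab, hab.symm, ne_eq, not_false_eq_true, mul_one]
    module
  have hKh : (-((β : ℂ) • H)).IsHermitian := by
    have : Hᴴ = H := (isHermitian_hamiltonian (n := n) G u).eq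
    rw [Matrix.IsHermitian, conjTranspose_neg, conjTranspose_smul, this]
    simp
  have hE0 : 0 ≤ E.trace.re := by
    have := norm_trace_mul_exp_le hKh (0 : Matrix _ _ ℂ) (R := 1) (by simp) (by simp)
    rwa [zero_mul, trace_zero, norm_zero, one_mul] at this
  set C := rotationGenerator φ J with hC
  have hCs : star C = -C := by
    simp only [hC, rotationGenerator, star_sum, star_smul, star_oneSite, hJs]
    rw [← Finset.sum_neg_distrib]
    refine Finset.sum_congr rfl fun z _ => ?_
    have : oneSite z (-J) = - oneSite z J := by
      simpa using oneSite_smul z (-1) J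
    simp [this]
  set A := oneSite x B * oneSite y D with hA
  have hAs : star A = A := by
    rw [hA, star_mul, star_oneSite, star_oneSite, hBs, hDs, (commute_oneSite hxy B D).eq]
  have hAn : ‖A‖ ≤ 4 := (norm_mul_le _ _).trans (by
    nlinarith [norm_oneSite_le x B, norm_oneSite_le y D, norm_nonneg (oneSite x B),
      norm_nonneg (oneSite y D)])
  -- Only the site `x` contributes: the coefficient at `y` is `φ y = 0`, and the other sites are
  -- disjoint from `A`.
  have hCA : C * A - A * C = (2 : ℂ) • (oneSite x D * oneSite y D) := by
    have hz : ∀ z, z ≠ x → Commute ((φ z : ℂ) • oneSite z J) A := by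
      intro z hz
      by_cases hzy : z = y
      · subst hzy; simp [hy]
      · exact ((commute_oneSite hz J B).mul_right (commute_oneSite hzy J D)).smul_left _
    have e1 := Finset.add_sum_erase Finset.univ (fun z => (φ z : ℂ) • oneSite z J)
      (Finset.mem_univ x)
    have e2 : Commute (∑ z ∈ Finset.univ.erase x, (φ z : ℂ) • oneSite z J) A :=
      Commute.sum_left _ _ _ fun z h => hz z (Finset.ne_of_mem_erase h)
    have e3 : C = oneSite x J + ∑ z ∈ Finset.univ.erase x, (φ z : ℂ) • oneSite z J := by
      rw [hC, rotationGenerator, ← e1]; simp [hx]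
    rw [e3, add_mul, mul_add, e2.eq, add_sub_add_right_eq_sub, hA, mul_assoc,
      ← (commute_oneSite hxy J D).eq, ← mul_assoc, ← mul_assoc, oneSite_mul, oneSite_mul, ← sub_mul,
      ← oneSite_sub, hJB, oneSite_smul, smul_mul_assoc]
  have bog := bogoliubov hβ (isHermitian_hamiltonian (n := n) G u) A C
  rw [← hH, ← hE, hCA, hAs, hCs] at bog
  -- Here `32 = 2 * 4²`. With the factor `16` from the double commutators and the `4 = |2|²` on the
  -- left of Bogoliubov's inequality, this gives `32 * 16 / 4 = 128`.
  have b1 : ((A * A + A * A) * E).trace.re ≤ 32 * E.trace.re := by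
    have hn : ‖A * A + A * A‖ ≤ 32 := (norm_add_le _ _).trans (by
      nlinarith [norm_mul_le A A, norm_nonneg A])
    refine (Complex.re_le_norm _).trans (norm_trace_mul_exp_le hKh _ hn ?_)
    rwa [star_add, star_mul, hAs]
  have b2 : (((C * H - H * C) * -C - -C * (C * H - H * C)) * E).trace.re ≤
      (16 * (n + 3) * ∑ e ∈ G.edgeFinset, gradSq φ e) * E.trace.re := by
    have e1 : (C * H - H * C) * -C - -C * (C * H - H * C) =
        ∑ e ∈ G.edgeFinset, ((C * Sym2.lift ⟨interaction n u, interaction_comm n u⟩ e -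
          Sym2.lift ⟨interaction n u, interaction_comm n u⟩ e * C) * C -
          C * (C * Sym2.lift ⟨interaction n u, interaction_comm n u⟩ e -
          Sym2.lift ⟨interaction n u, interaction_comm n u⟩ e * C)) := by
      rw [Finset.sum_sub_distrib, ← Finset.sum_mul, ← Finset.mul_sum, Finset.sum_sub_distrib,
        ← Finset.sum_mul, ← Finset.mul_sum, hH, hamiltonian]
      noncomm_ring
    rw [e1, Finset.sum_mul, trace_sum, Complex.re_sum, Finset.mul_sum, Finset.sum_mul]
    refine Finset.sum_le_sum fun e he => ?_
    induction e with
    | _ v w =>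
    have hvw : v ≠ w := by
      rw [SimpleGraph.mem_edgeFinset] at he
      exact G.ne_of_adj he
    have hi := norm_interaction_le (n := n) hu hvw
    simp only [Sym2.lift_mk, gradSq]
    rw [double_commutator_interaction u hvw hJt φ, smul_mul_assoc, trace_smul, smul_eq_mul,
      Complex.re_ofReal_mul]
    set K := oneSite w J with hK
    set h := interaction n u v w with hh
    have hKn : ‖K‖ ≤ 2 := (norm_oneSite_le w J).trans hJn
    have hKs : star K = -K := by
      rw [hK, star_oneSite, hJs]
      simpa using oneSite_smul w (-1) J
    have hhs : star h = h := star_interaction u v w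
    -- A double commutator costs `4 ‖K‖² ‖h‖`, with `‖K‖ ≤ 2`.
    have hn : ‖(K * h - h * K) * K - K * (K * h - h * K)‖ ≤ 16 * (n + 3) := by
      refine (norm_double_commutator_le K h).trans ?_
      have : ‖K‖ ^ 2 ≤ 4 := by nlinarith [norm_nonneg K]
      nlinarith [norm_nonneg h, mul_le_mul this hi (norm_nonneg h) (by norm_num)]
    have := (Complex.re_le_norm _).trans (norm_trace_mul_exp_le hKh _ hn (by
      have : star ((K * h - h * K) * K - K * (K * h - h * K)) =
          (K * h - h * K) * K - K * (K * h - h * K) := by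
        simp only [star_sub, star_mul, hKs, hhs]
        noncomm_ring
      rwa [this]))
    calc _ ≤ (φ v - φ w) ^ 2 * (16 * (n + 3) * E.trace.re) :=
          mul_le_mul_of_nonneg_left this (sq_nonneg _)
      _ = _ := by ring
  have hS : 0 ≤ ∑ e ∈ G.edgeFinset, gradSq φ e := Finset.sum_nonneg fun e _ => gradSq_nonneg φ e
  rw [smul_mul_assoc, trace_smul, smul_eq_mul, norm_mul, mul_pow] at bog
  have hfin : β * ((A * A + A * A) * E).trace.re *
      (((C * H - H * C) * -C - -C * (C * H - H * C)) * E).trace.re ≤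
      β * (32 * E.trace.re) * ((16 * (n + 3) * ∑ e ∈ G.edgeFinset, gradSq φ e) * E.trace.re) := by
    calc _ ≤ β * ((A * A + A * A) * E).trace.re *
          ((16 * (n + 3) * ∑ e ∈ G.edgeFinset, gradSq φ e) * E.trace.re) := by
          -- The bound on the double commutator may be inserted only because the other factor is a
          -- nonnegative trace.
          refine mul_le_mul_of_nonneg_left b2 (mul_nonneg hβ ?_)
          have := trace_star_mul_self_mul_exp_nonneg hKh A
          rw [hAs] at this
          rw [add_mul, trace_add, Complex.add_re]
          exact add_nonneg this this
      _ ≤ _ := by gcongr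
  have h2 : ‖(2 : ℂ)‖ ^ 2 = 4 := by norm_num
  rw [h2] at bog
  nlinarith [bog.trans hfin]

end MerminWagner

end QuantumSpin

/-! ### Counting in 2D-like graphs -/

namespace Is2DLike

variable {Λ : Type*} [Fintype Λ] {G : SimpleGraph Λ} {C : ℝ}

theorem card_sphere_le (h : Is2DLike G C) (x : Λ) {k : ℕ} (hk : 1 ≤ k) :
    ((Finset.univ.filter fun y => G.dist x y = k).card : ℝ) ≤ C * k := by
  have := h x k hk
  rwa [Set.ncard_eq_toFinset_card', Set.toFinset_ofPred] at this

theorem degree_le (h : Is2DLike G C) [DecidableRel G.Adj] (x : Λ) : (G.degree x : ℝ) ≤ C := by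
  have := h.card_sphere_le x le_rfl
  rw [Nat.cast_one, mul_one] at this
  refine le_trans (le_of_eq ?_) this
  rw [← SimpleGraph.card_neighborFinset_eq_degree]
  congr 2
  ext y
  simp [SimpleGraph.dist_eq_one_iff_adj]

/-- `C` is an arbitrary real number; a nonempty sphere of positive radius forces its sign. -/
theorem nonneg_of_reachable (h : Is2DLike G C) {x y : Λ} (hxy : x ≠ y) (hr : G.Reachable x y) :
    0 ≤ C := by
  have h1 : 1 ≤ G.dist x y := hr.pos_dist_of_ne hxy
  have h2 := (Nat.cast_nonneg _).trans (h.card_sphere_le x h1)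
  exact nonneg_of_mul_nonneg_left h2 (by exact_mod_cast h1)

/-- Radial sums are bounded by one-dimensional sums. -/
theorem sum_radial_le (h : Is2DLike G C) (x : Λ) (R : ℕ) {g : ℕ → ℝ} (hg : ∀ k, 0 ≤ g k) :
    ∑ v, (if G.dist x v ∈ Finset.Icc 1 R then g (G.dist x v) else 0) ≤
      ∑ k ∈ Finset.Icc 1 R, C * k * g k := by
  calc ∑ v, (if G.dist x v ∈ Finset.Icc 1 R then g (G.dist x v) else 0)
      = ∑ v, ∑ k ∈ Finset.Icc 1 R, if G.dist x v = k then g k else 0 := by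
        refine Finset.sum_congr rfl fun v _ => ?_
        rw [Finset.sum_ite_eq]
    _ = ∑ k ∈ Finset.Icc 1 R, ((Finset.univ.filter fun y => G.dist x y = k).card : ℝ) * g k := by
        rw [Finset.sum_comm]
        refine Finset.sum_congr rfl fun k _ => ?_
        rw [← Finset.sum_filter, Finset.sum_const, nsmul_eq_mul]
    _ ≤ _ := by
        refine Finset.sum_le_sum fun k hk => ?_
        exact mul_le_mul_of_nonneg_right
          (h.card_sphere_le x (Finset.mem_Icc.1 hk).1) (hg k)

end Is2DLike

/-! ### The logarithmic profile and its energy -/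

namespace QuantumSpin

variable {Λ : Type*} [Fintype Λ] {G : SimpleGraph Λ}

theorem sum_edgeFinset_le_sum_neighbors [DecidableEq Λ] [DecidableRel G.Adj] {f : Sym2 Λ → ℝ}
    (hf : ∀ e, 0 ≤ f e) :
    ∑ e ∈ G.edgeFinset, f e ≤ ∑ v, ∑ w ∈ G.neighborFinset v, f s(v, w) := by
  rw [Finset.sum_sigma']
  have hm : ∀ p ∈ Finset.univ.sigma fun v => G.neighborFinset v, s(p.1, p.2) ∈ G.edgeFinset := by
    rintro ⟨v, w⟩ hp
    simpa using hp
  rw [← Finset.sum_fiberwise_of_maps_to hm]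
  refine Finset.sum_le_sum fun e he => ?_
  induction e with
  | _ v w =>
  rw [SimpleGraph.mem_edgeFinset, SimpleGraph.mem_edgeSet] at he
  refine Finset.single_le_sum (f := fun p : (_ : Λ) × Λ => f s(p.1, p.2)) (fun p _ => hf _)
    (a := ⟨v, w⟩) ?_
  simpa using he

theorem log_succ_sub_log_le {k : ℕ} (hk : 1 ≤ k) :
    Real.log (k + 1) - Real.log k ≤ 1 / k := by
  have hk' : (0 : ℝ) < k := by exact_mod_cast hk
  rw [← Real.log_div (by positivity) hk'.ne']
  refine (Real.log_le_sub_one_of_pos (by positivity)).trans (le_of_eq ?_)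
  field_simp
  ring

/-- The logarithmic profile, equal to `1` at distance `0` and to `0` from distance `R` on. -/
noncomputable def logProfile (G : SimpleGraph Λ) (x : Λ) (R : ℕ) (z : Λ) : ℝ :=
  1 - Real.log ((min (G.dist x z) R : ℕ) + 1) / Real.log (R + 1)

omit [Fintype Λ] in
-- Distances to `x` change by at most one along an edge, and `log (k + 1) - log k ≤ 1 / k`. Only the
-- farther endpoint matters; the sum over both is for symmetry. On other components the default
-- value `0` of `dist` makes the profile constant, so they carry no energy.
theorem sq_logProfile_sub_le (x : Λ) {R : ℕ} {v w : Λ} (h : G.Adj v w) :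
    (logProfile G x R v - logProfile G x R w) ^ 2 ≤
      (if G.dist x v ∈ Finset.Icc 1 R then 1 / (G.dist x v * Real.log (R + 1)) ^ 2 else 0) +
      (if G.dist x w ∈ Finset.Icc 1 R then 1 / (G.dist x w * Real.log (R + 1)) ^ 2 else 0) := by
  have n1 : ∀ v, 0 ≤ if G.dist x v ∈ Finset.Icc 1 R then
      1 / ((G.dist x v : ℝ) * Real.log (R + 1)) ^ 2 else 0 := fun v => by
    split_ifs <;> positivity
  wlog hle : G.dist x v ≤ G.dist x w generalizing v w
  · rw [← neg_sub, neg_sq, add_comm]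
    exact this h.symm (le_of_not_ge hle)
  have h1 : G.dist x w ≤ G.dist x v + 1 := by
    have := h.reachable.dist_triangle_right x
    rwa [SimpleGraph.dist_eq_one_iff_adj.2 h] at this
  by_cases h2 : min (G.dist x v) R = min (G.dist x w) R
  · rw [logProfile, logProfile, h2]
    simpa using add_nonneg (n1 v) (n1 w)
  · have h3 : G.dist x w = G.dist x v + 1 := by grind
    have h4 : G.dist x v < R := by grind
    refine le_trans ?_ (le_add_of_nonneg_left (n1 v))
    rw [if_pos (Finset.mem_Icc.2 ⟨by lia, by lia⟩), logProfile, logProfile, min_eq_left h4.le,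
      min_eq_left (by lia : G.dist x w ≤ R), h3]
    set k := G.dist x v
    have hL : 0 ≤ Real.log (R + 1) := Real.log_nonneg (by norm_cast; lia)
    have h5 := log_succ_sub_log_le (k := k + 1) (by lia)
    have h6 : Real.log ((k : ℝ) + 1) ≤ Real.log (((k + 1 : ℕ) : ℝ) + 1) :=
      Real.log_le_log (by positivity) (by push_cast; linarith)
    have e : 1 - Real.log ((k : ℝ) + 1) / Real.log (R + 1) -
        (1 - Real.log (((k + 1 : ℕ) : ℝ) + 1) / Real.log (R + 1)) =
        (Real.log (((k + 1 : ℕ) : ℝ) + 1) - Real.log ((k : ℝ) + 1)) / Real.log (R + 1) := by ring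
    rw [e, one_div, ← inv_pow]
    refine pow_le_pow_left₀ (div_nonneg (sub_nonneg.2 h6) hL) ?_ 2
    rw [mul_inv, div_eq_mul_inv]
    refine mul_le_mul_of_nonneg_right ?_ (inv_nonneg.2 hL)
    push_cast at h5 ⊢
    rwa [one_div] at h5

/-- The sphere of radius `k` contributes at most `C k / (k L)²` with `L = log (R + 1)`, so the total
is a harmonic sum over `L²`, of order `1 / L`. The degree bound supplies the second factor `C`. -/
theorem sum_gradSq_logProfile_le [DecidableEq Λ] [DecidableRel G.Adj] {C : ℝ} (h : Is2DLike G C)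
    (hC : 0 ≤ C) (x : Λ) {R : ℕ} (hR : 1 ≤ R) :
    ∑ e ∈ G.edgeFinset, gradSq (logProfile G x R) e ≤ 6 * C ^ 2 / Real.log (R + 1) := by
  set L := Real.log ((R : ℝ) + 1) with hLdef
  have hR' : (1 : ℝ) ≤ R := by exact_mod_cast hR
  -- This absorbs the constant of the harmonic sum: `1 + L ≤ 3 L`, and `6 = 2 * 3`.
  have hL : 1 / 2 ≤ L := by
    have : Real.log 2 ≤ L := Real.log_le_log (by norm_num) (by linarith)
    linarith [Real.log_two_gt_d9]
  set g : Λ → ℝ := fun v =>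
    if G.dist x v ∈ Finset.Icc 1 R then 1 / ((G.dist x v : ℝ) * L) ^ 2 else 0 with hg
  have hg0 : ∀ v, 0 ≤ g v := fun v => by simp only [hg]; split_ifs <;> positivity
  have deg : ∀ v, ∑ w ∈ G.neighborFinset v, g v ≤ C * g v := fun v => by
    rw [Finset.sum_const, nsmul_eq_mul, SimpleGraph.card_neighborFinset_eq_degree]
    exact mul_le_mul_of_nonneg_right (h.degree_le v) (hg0 v)
  have s1 : ∑ e ∈ G.edgeFinset, gradSq (logProfile G x R) e ≤ 2 * (C * ∑ v, g v) := by
    refine (sum_edgeFinset_le_sum_neighbors (gradSq_nonneg _)).trans ?_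
    calc ∑ v, ∑ w ∈ G.neighborFinset v, gradSq (logProfile G x R) s(v, w)
        ≤ ∑ v, ∑ w ∈ G.neighborFinset v, (g v + g w) := by
          refine Finset.sum_le_sum fun v _ => Finset.sum_le_sum fun w hw => ?_
          exact sq_logProfile_sub_le x ((SimpleGraph.mem_neighborFinset _ _ _).1 hw)
      _ = ∑ v, ∑ w ∈ G.neighborFinset v, g v + ∑ v, ∑ w ∈ G.neighborFinset v, g w := by
          simp only [Finset.sum_add_distrib]
      _ = 2 * ∑ v, ∑ w ∈ G.neighborFinset v, g v := by
          rw [two_mul]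
          congr 1
          refine Finset.sum_comm' fun v w => ?_
          simp [SimpleGraph.adj_comm]
      _ ≤ 2 * (C * ∑ v, g v) := by
          rw [Finset.mul_sum Finset.univ g]
          gcongr with v
          exact deg v
  have s2 : ∑ v, g v ≤ C / L ^ 2 * (1 + L) := by
    refine (h.sum_radial_le x R (g := fun k => 1 / ((k : ℝ) * L) ^ 2) fun k => by positivity).trans
      ?_
    have e : ∀ k ∈ Finset.Icc 1 R, C * k * (1 / ((k : ℝ) * L) ^ 2) = C / L ^ 2 * (k : ℝ)⁻¹ := by
      intro k hk
      have : (k : ℝ) ≠ 0 := by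
        have := (Finset.mem_Icc.1 hk).1
        positivity
      field_simp
    rw [Finset.sum_congr rfl e, ← Finset.mul_sum]
    refine mul_le_mul_of_nonneg_left ?_ (by positivity)
    have := harmonic_le_one_add_log R
    rw [harmonic_eq_sum_Icc] at this
    push_cast at this
    refine this.trans (add_le_add_right (Real.log_le_log (by linarith) (by linarith)) 1)
  refine s1.trans ?_
  calc 2 * (C * ∑ v, g v) ≤ 2 * (C * (C / L ^ 2 * (1 + L))) := by gcongr
    _ ≤ 2 * (C * (C / L ^ 2 * (3 * L))) := by gcongr; linarith
    _ = _ := by field_simp; ring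

end QuantumSpin

/-! ### Spin configurations as colourings of loops -/

namespace RandomLoops

variable {Λ : Type*} {G : SimpleGraph Λ} {n : ℕ}

/-- Compatibility of the spin configurations just before and just after a transition. -/
def Compat (a : G.edgeSet × Bool) (σ τ : Λ → Fin (n + 1)) : Prop :=
  (∀ z, z ∉ (a.1 : Sym2 Λ) → σ z = τ z) ∧
    ∀ x y, (a.1 : Sym2 Λ) = s(x, y) →
      (a.2 = true → σ x = τ y) ∧ (a.2 ≠ true → σ x = σ y ∧ τ x = τ y)

/-- Time-periodic sequences of spin configurations compatible with a sequence of transitions. -/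
def IsClosedPath {N : ℕ} (a : Fin N → G.edgeSet × Bool) (σ : Fin (N + 1) → Λ → Fin (n + 1)) :
    Prop :=
  σ 0 = σ (Fin.last N) ∧ ∀ k, Compat (a k) (σ k.castSucc) (σ k.succ)

/-- The index `r` counts the transitions strictly before `s`, and so tells which spin configuration
is in force at `s`. -/
theorem exists_rank {N : ℕ} {t : Fin N → ℝ} (ht : StrictMono t) (s : ℝ) :
    ∃ r : Fin (N + 1), ∀ k : Fin N, k.castSucc < r ↔ t k < s := by
  classical
  have hne : (Finset.univ.filter fun r : Fin (N + 1) =>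
      ∀ k : Fin N, r ≤ k.castSucc → s ≤ t k).Nonempty :=
    ⟨Fin.last N, by simp [Fin.last_le_iff, Fin.castSucc_ne_last]⟩
  obtain ⟨r, hr, hmin⟩ := Finset.exists_min_image _ id hne
  simp only [Finset.mem_filter, Finset.mem_univ, true_and, id] at hr hmin
  refine ⟨r, fun k => ⟨fun h => ?_, fun h => ?_⟩⟩
  · by_contra! hk
    refine absurd (hmin k.castSucc fun l hl => hk.trans (ht.monotone ?_)) (not_le.2 h)
    simpa using hl
  · by_contra! hk
    exact absurd (hr k hk) (not_le.2 h)

/-- One sampling time is chosen in each gap between consecutive transitions, to read off the loop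
through a site in that time slot. For `β = 0` there are no transitions and the single sampling time
is `0`. -/
theorem exists_interlacing {N : ℕ} {t : Fin N → ℝ} (ht : StrictMono t) {β : ℝ} (hβ : 0 ≤ β)
    (h : ∀ k, t k ∈ Ioo 0 β) :
    ∃ s : Fin (N + 1) → ℝ, (∀ i, s i ∈ Icc 0 β) ∧ (∀ i k, k.castSucc < i → t k < s i) ∧
      ∀ i k, i ≤ Fin.castSucc k → s i < t k := by
  rcases hβ.eq_or_lt with rfl | hβ
  · refine ⟨fun _ => 0, by simp, fun i k => ?_, fun i k => ?_⟩ <;> exact absurd (h k) (by simp)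
  have (i : Fin (N + 1)) : ∃ s : ℝ, s ∈ Icc 0 β ∧ (∀ k, k.castSucc < i → t k < s) ∧
      ∀ k, i ≤ Fin.castSucc k → s < t k := by
    classical
    obtain ⟨m, h1, h2⟩ := Order.exists_between_finsets
      (insert 0 ((Finset.univ.filter fun k => Fin.castSucc k < i).image t))
      (insert β ((Finset.univ.filter fun k => i ≤ Fin.castSucc k).image t)) (by
        intro a ha b hb
        simp only [Finset.mem_insert, Finset.mem_image, Finset.mem_filter, Finset.mem_univ,
          true_and] at ha hb
        obtain rfl | ⟨k, hk, rfl⟩ := ha <;> obtain rfl | ⟨l, hl, rfl⟩ := hb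
        · exact hβ
        · exact (h l).1
        · exact (h k).2
        · exact ht (by simpa using hk.trans_le hl))
    refine ⟨m, ⟨(h1 0 (by simp)).le, (h2 β (by simp)).le⟩, fun k hk => h1 _ ?_, fun k hk => h2 _ ?_⟩
    · simp only [Finset.mem_insert, Finset.mem_image, Finset.mem_filter, Finset.mem_univ, true_and]
      exact Or.inr ⟨k, hk, rfl⟩
    · simp only [Finset.mem_insert, Finset.mem_image, Finset.mem_filter, Finset.mem_univ, true_and]
      exact Or.inr ⟨k, hk, rfl⟩
  choose s hs using this
  exact ⟨s, fun i => (hs i).1, fun i => (hs i).2.1, fun i => (hs i).2.2⟩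

/-- A site that is not touched by the transitions between two indices keeps its spin. -/
theorem IsClosedPath.eq_of_forall_notMem {N : ℕ} {a : Fin N → G.edgeSet × Bool}
    {σ : Fin (N + 1) → Λ → Fin (n + 1)} (hσ : IsClosedPath a σ) {z : Λ} {i : Fin (N + 1)} :
    ∀ {j : Fin (N + 1)}, i ≤ j →
      (∀ k : Fin N, i ≤ k.castSucc → k.castSucc < j → z ∉ ((a k).1 : Sym2 Λ)) →
      σ i z = σ j z := by
  intro j
  induction j using Fin.induction with
  | zero => intro hij _; rw [Fin.le_zero_iff.1 hij]
  | succ k ih =>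
    intro hij h
    rcases hij.eq_or_lt with rfl | hlt
    · rfl
    · have hik : i ≤ k.castSucc := by
        rw [Fin.le_def]; rw [Fin.lt_def] at hlt; simp at hlt ⊢; lia
      rw [ih hik fun l hl hl' => h l hl (hl'.trans (Fin.castSucc_lt_succ (i := k)))]
      exact (hσ.2 k).1 z (h k hik (Fin.castSucc_lt_succ (i := k)))

namespace Config

variable {ω : Config G} {β : ℝ} {π : Equiv.Perm (Fin ω.1)}

/-- The sequence of transitions along a permutation, without their times. -/
def marks (ω : Config G) (π : Equiv.Perm (Fin ω.1)) (k : Fin ω.1) : G.edgeSet × Bool :=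
  ((ω.2 (π k)).1, (ω.2 (π k)).2.1)

/-- The transitions occur at distinct times inside `(0,β)`, and `π` puts them in order. -/
structure IsSorted (ω : Config G) (β : ℝ) (π : Equiv.Perm (Fin ω.1)) : Prop where
  strictMono : StrictMono fun k => ω.time (π k)
  mem_Ioo : ∀ i, ω.time i ∈ Ioo 0 β

theorem IsSorted.zero_mem_points (h : ω.IsSorted β π) (hβ : 0 ≤ β) (x : Λ) :
    (x, 0) ∈ ω.points β :=
  ⟨⟨le_rfl, hβ⟩, fun i _ hi => (h.mem_Ioo i).1.ne' hi⟩

theorem IsSorted.beta_mem_points (h : ω.IsSorted β π) (hβ : 0 ≤ β) (x : Λ) :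
    (x, β) ∈ ω.points β :=
  ⟨⟨hβ, le_rfl⟩, fun i _ hi => (h.mem_Ioo i).2.ne hi⟩

section Spin

variable {σ : Fin (ω.1 + 1) → Λ → Fin (n + 1)} {r : ℝ → Fin (ω.1 + 1)}
  (hr : ∀ s k, k.castSucc < r s ↔ ω.time (π k) < s)

include hr

theorem spin_eq_of_le (hσ : IsClosedPath (ω.marks π) σ) {x : Λ} {s t : ℝ} (hst : s ≤ t)
    (hf : ω.Free x (Ico s t)) : σ (r s) x = σ (r t) x := by
  refine hσ.eq_of_forall_notMem ?_ fun k h1 h2 hx => ?_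
  · by_contra! h
    have hl : (r t).val < ω.1 := by have := (r s).2; rw [Fin.lt_def] at h; lia
    have h1 := (hr s ⟨r t, hl⟩).1 h
    have h2 := (hr t ⟨r t, hl⟩).2 (h1.trans_le hst)
    exact lt_irrefl _ h2
  · refine hf (π k) hx ⟨?_, (hr t k).1 h2⟩
    exact not_lt.1 fun h => not_lt.2 h1 ((hr s k).2 h)

theorem spin_before (h : ω.IsSorted β π) (hσ : IsClosedPath (ω.marks π) σ) {x : Λ} {s : ℝ}
    {k : Fin ω.1} (hs : s < ω.time (π k)) (hf : ω.Free x (Ico s (ω.time (π k)))) :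
    σ (r s) x = σ k.castSucc x := by
  refine hσ.eq_of_forall_notMem ?_ fun l h1 h2 hx => ?_
  · exact not_lt.1 fun hk => absurd ((hr s k).1 hk) (not_lt.2 hs.le)
  · refine hf (π l) hx ⟨?_, h.strictMono (by simpa using h2)⟩
    exact not_lt.1 fun h => not_lt.2 h1 ((hr s l).2 h)

theorem spin_after (h : ω.IsSorted β π) (hσ : IsClosedPath (ω.marks π) σ) {x : Λ} {s : ℝ}
    {k : Fin ω.1} (hs : ω.time (π k) < s) (hf : ω.Free x (Ioc (ω.time (π k)) s)) :
    σ (r s) x = σ k.succ x := by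
  symm
  refine hσ.eq_of_forall_notMem ?_ fun l h1 h2 hx => ?_
  · exact Fin.castSucc_lt_iff_succ_le.1 ((hr s k).2 hs)
  · refine hf (π l) hx ⟨h.strictMono ?_, ((hr s l).1 h2).le⟩
    rw [Fin.le_def] at h1
    rw [Fin.lt_def]
    simpa [Nat.succ_le_iff] using h1

/-- Each kind of step matches one clause of compatibility: untouched sites for vertical motion,
periodicity in time, and the rules for crosses and double bars. Hence the spin is constant along a
loop. -/
theorem spin_eq_of_step (h : ω.IsSorted β π) (hσ : IsClosedPath (ω.marks π) σ) {p q : Λ × ℝ}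
    (hpq : Step ω β p q) : σ (r p.2) p.1 = σ (r q.2) q.1 := by
  cases hpq with
  | vertical hst hf =>
    exact spin_eq_of_le hr hσ hst fun i hi hi' => hf i hi (Ico_subset_Icc_self hi')
  | @period x =>
    have h0 : r 0 = 0 := by
      rw [← Fin.le_zero_iff]
      by_contra! h0
      have hN : 0 < ω.1 := by
        by_contra hN
        have := (r 0).2
        rw [Fin.lt_def] at h0
        simp at h0; lia
      exact absurd ((hr 0 ⟨0, hN⟩).1 h0) (not_lt.2 (h.mem_Ioo _).1.le)
    have hl : r β = Fin.last _ := by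
      rw [← Fin.last_le_iff]
      by_contra! h0
      have := (hr β ⟨r β, by simpa [Fin.lt_def] using h0⟩).2 (h.mem_Ioo _).2
      exact lt_irrefl _ this
    simp only [h0, hl]
    rw [hσ.1]
  | @cross x y s t i he hc hs ht hx hy =>
    obtain ⟨k, rfl⟩ := π.surjective i
    rw [spin_before hr h hσ hs hx, spin_after hr h hσ ht hy]
    exact ((hσ.2 k).2 x y he).1 hc
  | @barBelow x y s t i he hc hs ht hx hy =>
    obtain ⟨k, rfl⟩ := π.surjective i
    rw [spin_before hr h hσ hs hx, spin_before hr h hσ ht hy]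
    exact (((hσ.2 k).2 x y he).2 hc).1
  | @barAbove x y s t i he hc hs ht hx hy =>
    obtain ⟨k, rfl⟩ := π.surjective i
    rw [spin_after hr h hσ hs hx, spin_after hr h hσ ht hy]
    exact (((hσ.2 k).2 x y he).2 hc).2

end Spin

theorem loopOf_eq_of_step {p q : ω.points β} (h : Step ω β p.1 q.1) :
    ω.loopOf β p = ω.loopOf β q :=
  Quotient.sound (Relation.EqvGen.rel p q h)

theorem loopOf_eq_of_free {x : Λ} {s t : ℝ} (hs : (x, s) ∈ ω.points β) (ht : (x, t) ∈ ω.points β)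
    (hf : ∀ i, x ∈ ω.edge i → ω.time i ∉ uIcc s t) :
    ω.loopOf β ⟨(x, s), hs⟩ = ω.loopOf β ⟨(x, t), ht⟩ := by
  rcases le_total s t with hst | hst
  · rw [uIcc_of_le hst] at hf
    exact loopOf_eq_of_step (.vertical hst hf)
  · rw [uIcc_of_ge hst] at hf
    exact (loopOf_eq_of_step (p := ⟨(x, t), ht⟩) (q := ⟨(x, s), hs⟩) (.vertical hst hf)).symm

/-- Assignments of spins to loops correspond to compatible time-periodic sequences of spin
configurations. -/
theorem IsSorted.exists_equiv (h : ω.IsSorted β π) (hβ : 0 ≤ β) (n : ℕ) :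
    ∃ Φ : (ω.Loops β → Fin (n + 1)) ≃
        {σ : Fin (ω.1 + 1) → Λ → Fin (n + 1) // IsClosedPath (ω.marks π) σ},
      ∀ c x, (Φ c).1 0 x = c (ω.loopOf β ⟨(x, 0), h.zero_mem_points hβ x⟩) := by
  obtain ⟨s, hs, hlo, hhi⟩ := exists_interlacing h.strictMono hβ fun k => h.mem_Ioo (π k)
  choose r hr using exists_rank h.strictMono
  have hpt : ∀ z i, (z, s i) ∈ ω.points β := by
    refine fun z i => ⟨hs i, fun j _ hj => ?_⟩
    obtain ⟨k, rfl⟩ := π.surjective j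
    rcases lt_or_ge k.castSucc i with hk | hk
    · exact (hlo i k hk).ne hj
    · exact (hhi i k hk).ne' hj
  have hrs : ∀ i, r (s i) = i := by
    intro i
    have key : ∀ k : Fin ω.1, k.castSucc < r (s i) ↔ k.castSucc < i := by
      intro k
      rw [hr]
      refine ⟨fun h1 => ?_, hlo i k⟩
      by_contra! h2
      exact absurd (hhi i k h2) (not_lt.2 h1.le)
    apply le_antisymm
    · by_contra! hlt
      have hl : i.val < ω.1 := by have := (r (s i)).2; rw [Fin.lt_def] at hlt; lia
      exact lt_irrefl i ((key ⟨i, hl⟩).1 hlt)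
    · by_contra! hlt
      have hl : (r (s i)).val < ω.1 := by have := i.2; rw [Fin.lt_def] at hlt; lia
      exact lt_irrefl (r (s i)) ((key ⟨r (s i), hl⟩).2 hlt)
  let L : Λ → Fin (ω.1 + 1) → ω.Loops β := fun z i => ω.loopOf β ⟨(z, s i), hpt z i⟩
  have hL0 : ∀ z, L z 0 = ω.loopOf β ⟨(z, 0), h.zero_mem_points hβ z⟩ := by
    refine fun z => loopOf_eq_of_free _ _ fun j _ hj => ?_
    obtain ⟨k, rfl⟩ := π.surjective j
    rw [uIcc_of_ge (hs 0).1] at hj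
    exact absurd (hhi 0 k (Fin.zero_le _)) (not_lt.2 hj.2)
  have hLlast : ∀ z, L z (Fin.last _) = ω.loopOf β ⟨(z, 0), h.zero_mem_points hβ z⟩ := by
    intro z
    trans ω.loopOf β ⟨(z, β), h.beta_mem_points hβ z⟩
    · refine loopOf_eq_of_free _ _ fun j _ hj => ?_
      obtain ⟨k, rfl⟩ := π.surjective j
      rw [uIcc_of_le (hs _).2] at hj
      exact absurd (hlo (Fin.last _) k (Fin.castSucc_lt_last k)) (not_lt.2 hj.1)
    · exact (loopOf_eq_of_step .period).symm
  have before : ∀ k : Fin ω.1, s k.castSucc < ω.time (π k) := fun k => hhi _ k le_rfl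
  have after : ∀ k : Fin ω.1, ω.time (π k) < s k.succ := fun k =>
    hlo _ k (Fin.castSucc_lt_succ (i := k))
  have fb : ∀ (k : Fin ω.1) z, ω.Free z (Ico (s k.castSucc) (ω.time (π k))) := by
    intro k z j _ hj
    obtain ⟨l, rfl⟩ := π.surjective j
    have hl : l < k := h.strictMono.lt_iff_lt.1 hj.2
    exact absurd (hlo k.castSucc l (by simpa using hl)) (not_lt.2 hj.1)
  have fa : ∀ (k : Fin ω.1) z, ω.Free z (Ioc (ω.time (π k)) (s k.succ)) := by
    intro k z j _ hj
    obtain ⟨l, rfl⟩ := π.surjective j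
    have hl : k < l := h.strictMono.lt_iff_lt.1 hj.1
    exact absurd (hhi k.succ l (by rw [Fin.le_def]; simpa [Nat.succ_le_iff] using hl))
      (not_lt.2 hj.2)
  have hLcompat : ∀ c : ω.Loops β → Fin (n + 1), IsClosedPath (ω.marks π) fun i z => c (L z i) := by
    intro c
    refine ⟨funext fun z => congrArg c ((hL0 z).trans (hLlast z).symm),
      fun k => ⟨fun z hz => ?_, fun x y hxy => ?_⟩⟩
    · refine congrArg c (loopOf_eq_of_free (hpt z _) (hpt z _) fun j hj hj' => ?_)
      obtain ⟨l, rfl⟩ := π.surjective j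
      rw [uIcc_of_le ((before k).trans (after k)).le] at hj'
      rcases lt_trichotomy l k with hl | rfl | hl
      · exact fb k z (π l) hj ⟨hj'.1, h.strictMono hl⟩
      · exact hz hj
      · exact fa k z (π l) hj ⟨h.strictMono hl, hj'.2⟩
    · refine ⟨fun hc => ?_, fun hc => ⟨?_, ?_⟩⟩
      · exact congrArg c (loopOf_eq_of_step
          (.cross (i := π k) hxy hc (before k) (after k) (fb k x) (fa k y)))
      · exact congrArg c (loopOf_eq_of_step
          (.barBelow (i := π k) hxy hc (before k) (before k) (fb k x) (fb k y)))
      · exact congrArg c (loopOf_eq_of_step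
          (.barAbove (i := π k) hxy hc (after k) (after k) (fa k x) (fa k y)))
  -- Every point lies on the loop of the sampling point of its slot. If its time is that of a
  -- transition, that transition is at other sites, since the point is off the support of `ω`.
  have hLr : ∀ p : ω.points β, L p.1.1 (r p.1.2) = ω.loopOf β p := by
    rintro ⟨⟨z, t⟩, hp⟩
    refine loopOf_eq_of_free _ _ fun j hj hj' => ?_
    obtain ⟨k, rfl⟩ := π.surjective j
    rcases lt_or_ge k.castSucc (r t) with hk | hk
    · have h1 := (hr t k).1 hk
      have h2 := hlo _ k hk
      rw [mem_uIcc] at hj'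
      rcases hj' with hj' | hj' <;> linarith [hj'.1, hj'.2]
    · have h1 : t ≤ ω.time (π k) := not_lt.1 fun h1 => not_lt.2 hk ((hr t k).2 h1)
      have h2 := hhi _ k hk
      rw [mem_uIcc] at hj'
      refine hp.2 (π k) hj (mem_singleton_iff.2 ?_)
      rcases hj' with hj' | hj' <;> dsimp only at hj' ⊢ <;> linarith [hj'.1, hj'.2]
  -- A colouring is sampled slot by slot; conversely, the colour of a loop is the spin at any of its
  -- points.
  refine ⟨⟨fun c => ⟨fun i z => c (L z i), hLcompat c⟩, fun σ => Quotient.lift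
    (fun p : ω.points β => σ.1 (r p.1.2) p.1.1) ?_, ?_, ?_⟩, fun c x => ?_⟩
  · have key : ∀ p q : ω.points β,
        Relation.EqvGen (fun p q : ω.points β => Step ω β p.1 q.1) p q →
          σ.1 (r p.1.2) p.1.1 = σ.1 (r q.1.2) q.1.1 := by
      intro p q hpq
      induction hpq with
      | rel p q hs => exact spin_eq_of_step hr h σ.2 hs
      | refl p => rfl
      | symm p q _ ih => exact ih.symm
      | trans p q r _ _ ih1 ih2 => exact ih1.trans ih2
    exact key
  · intro c
    ext1 l
    induction l using Quotient.inductionOn with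
    | _ p => exact congrArg c (hLr p)
  · intro σ
    ext1
    funext i z
    change σ.1 (r (s i)) z = σ.1 i z
    rw [hrs]
  · exact congrArg c (hL0 x)

end Config

end RandomLoops

/-! ### Sums over colourings of the loops -/

theorem Fintype.sum_fun_apply {L κ R : Type*} [Fintype L] [DecidableEq L] [Fintype κ] [CommRing R]
    (g : κ → R) (a : L) :
    (Fintype.card κ : R) * ∑ c : L → κ, g (c a) =
      (∑ v, g v) * (Fintype.card κ : R) ^ Fintype.card L := by
  rw [← (Equiv.funSplitAt a κ).symm.sum_comp, Fintype.sum_prod_type]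
  have e : Fintype.card L = Fintype.card {j // j ≠ a} + 1 := by
    rw [Fintype.card_subtype_compl, Fintype.card_subtype_eq]
    have := Fintype.card_pos_iff.2 ⟨a⟩
    lia
  rw [e, pow_succ]
  simp [Equiv.funSplitAt, Equiv.piSplitAt, Finset.sum_mul]
  rw [Finset.mul_sum]
  refine Finset.sum_congr rfl fun v _ => by ring

/-- The colours of two distinct loops are summed independently, and the sum over one of them already
vanishes. -/
theorem Fintype.sum_fun_apply_mul_apply_eq_zero {L κ R : Type*} [Fintype L] [DecidableEq L]
    [Fintype κ] [CommRing R] {f : κ → R} (hf : ∑ v, f v = 0) {a b : L} (hab : a ≠ b) :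
    ∑ c : L → κ, f (c a) * f (c b) = 0 := by
  rw [← (Equiv.funSplitAt a κ).symm.sum_comp, Fintype.sum_prod_type, Finset.sum_comm]
  refine Finset.sum_eq_zero fun c _ => ?_
  simp [Equiv.funSplitAt, Equiv.piSplitAt, hab.symm, ← Finset.sum_mul, hf]

namespace RandomLoops

variable {Λ : Type*} [Fintype Λ] [DecidableEq Λ] {G : SimpleGraph Λ} {n : ℕ}

open Classical in
/-- The sum over compatible time-periodic sequences of a function of the initial configuration. -/
noncomputable def pathSum (F : (Λ → Fin (n + 1)) → ℝ) {N : ℕ} (a : Fin N → G.edgeSet × Bool) : ℝ :=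
  ∑ σ : Fin (N + 1) → Λ → Fin (n + 1), if IsClosedPath a σ then F (σ 0) else 0

namespace Config

variable {ω : Config G} {β : ℝ} {π : Equiv.Perm (Fin ω.1)}

omit [DecidableEq Λ] in
-- Colourings with two colours correspond to finitely many closed paths, and the indicators of
-- single loops are distinct colourings.
theorem IsSorted.finite_loops (h : ω.IsSorted β π) (hβ : 0 ≤ β) : Finite (ω.Loops β) := by
  classical
  obtain ⟨Φ, -⟩ := h.exists_equiv hβ 1
  have : Finite (ω.Loops β → Fin 2) := Finite.of_equiv _ Φ.symm
  refine Finite.of_injective (fun l : ω.Loops β => (Pi.single l 1 : ω.Loops β → Fin 2))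
    fun l l' e => ?_
  by_contra hne
  have := congrFun e l
  simp [hne] at this

theorem IsSorted.pathSum_eq (h : ω.IsSorted β π) (hβ : 0 ≤ β) [Fintype (ω.Loops β)]
    [DecidableEq (ω.Loops β)] (F : (Λ → Fin (n + 1)) → ℝ) :
    pathSum F (ω.marks π) = ∑ c : ω.Loops β → Fin (n + 1),
      F fun x => c (ω.loopOf β ⟨(x, 0), h.zero_mem_points hβ x⟩) := by
  classical
  obtain ⟨Φ, hΦ⟩ := h.exists_equiv hβ n
  rw [pathSum, ← Finset.sum_filter, Finset.sum_subtype (p := IsClosedPath (ω.marks π)) _ (by simp),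
    ← Φ.sum_comp]
  refine Finset.sum_congr rfl fun c _ => ?_
  congr 1
  funext x
  exact hΦ c x

theorem IsSorted.pathSum_one (h : ω.IsSorted β π) (hβ : 0 ≤ β) :
    pathSum (n := n) (fun _ => 1) (ω.marks π) = ((n : ℝ) + 1) ^ ω.numLoops β := by
  classical
  have := h.finite_loops hβ
  have := Fintype.ofFinite (ω.Loops β)
  rw [h.pathSum_eq hβ, numLoops, Nat.card_eq_fintype_card]
  simp

open Classical in
theorem IsSorted.pathSum_mul (h : ω.IsSorted β π) (hβ : 0 ≤ β) {f : Fin (n + 1) → ℝ}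
    (hf : ∑ v, f v = 0) (x y : Λ) :
    ((n : ℝ) + 1) * pathSum (fun σ => f (σ x) * f (σ y)) (ω.marks π) =
      if ω ∈ sameLoop G β x y 0 then (∑ v, f v ^ 2) * ((n : ℝ) + 1) ^ ω.numLoops β else 0 := by
  have := h.finite_loops hβ
  have := Fintype.ofFinite (ω.Loops β)
  rw [h.pathSum_eq hβ, numLoops, Nat.card_eq_fintype_card]
  have hiff : ω ∈ sameLoop G β x y 0 ↔ ω.loopOf β ⟨(x, 0), h.zero_mem_points hβ x⟩ =
      ω.loopOf β ⟨(y, 0), h.zero_mem_points hβ y⟩ :=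
    ⟨fun ⟨_, _, e⟩ => e, fun e => ⟨_, _, e⟩⟩
  split_ifs with hs
  · rw [hiff] at hs
    have := Fintype.sum_fun_apply (fun v => f v ^ 2)
      (ω.loopOf β ⟨(x, 0), h.zero_mem_points hβ x⟩)
    simp only [Fintype.card_fin, Nat.cast_add, Nat.cast_one] at this
    rw [← this]
    simp only [sq, hs]
  · rw [hiff] at hs
    rw [Fintype.sum_fun_apply_mul_apply_eq_zero hf hs, mul_zero]

end Config

omit [Fintype Λ] [DecidableEq Λ] in
/-- Every sequence of transitions is realized by some configuration with ordered times. -/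
theorem exists_isSorted {N : ℕ} (a : Fin N → G.edgeSet × Bool) :
    ∃ p : Fin N → Transition G, Config.IsSorted (⟨N, p⟩ : Config G) 1 1 ∧
      Config.marks (⟨N, p⟩ : Config G) 1 = a := by
  refine ⟨fun k => ((a k).1, (a k).2, ((k : ℝ) + 1) / (N + 1)), ⟨fun k l hkl => ?_, fun k => ?_⟩,
    rfl⟩
  · have : (k : ℝ) < l := by exact_mod_cast hkl
    simp only [Config.time, Equiv.Perm.one_apply]
    gcongr
  · have : (k : ℝ) < N := by exact_mod_cast k.2
    simp only [Config.time]
    refine ⟨by positivity, ?_⟩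
    rw [div_lt_one (by positivity)]
    linarith

theorem pathSum_one_nonneg {N : ℕ} (a : Fin N → G.edgeSet × Bool) :
    0 ≤ pathSum (n := n) (fun _ => 1) a := by
  classical
  exact Finset.sum_nonneg fun σ _ => by split_ifs <;> simp

/-- The summands have no sign, but once the marks are given ordered times the loop formula applies,
and it is manifestly nonnegative. This permits the passage to `ENNReal` integrals. -/
theorem pathSum_mul_nonneg {N : ℕ} (a : Fin N → G.edgeSet × Bool) {f : Fin (n + 1) → ℝ}
    (hf : ∑ v, f v = 0) (x y : Λ) : 0 ≤ pathSum (fun σ => f (σ x) * f (σ y)) a := by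
  classical
  obtain ⟨p, hp, rfl⟩ := exists_isSorted a
  have h := hp.pathSum_mul zero_le_one hf x y
  refine nonneg_of_mul_nonneg_right (a := (n : ℝ) + 1) ?_ (by positivity)
  rw [h]
  split_ifs
  · have : 0 ≤ ∑ v, f v ^ 2 := Finset.sum_nonneg fun v _ => sq_nonneg _
    positivity
  · exact le_rfl

end RandomLoops

/-! ### Expansion of products of matrices over paths -/

section MatrixExpansion

open Matrix

variable {X I R : Type*} [Fintype X] [DecidableEq X] [Fintype I] [CommRing R]

theorem Matrix.prod_ofFn_apply {N : ℕ} (O : Fin N → Matrix X X R) (i j : X) :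
    (List.ofFn O).prod i j = ∑ σ : Fin (N + 1) → X,
      if σ 0 = i ∧ σ (Fin.last N) = j then ∏ k : Fin N, O k (σ k.castSucc) (σ k.succ) else 0 := by
  induction N generalizing i with
  | zero =>
    simp only [List.ofFn_zero, List.prod_nil, Matrix.one_apply, Finset.univ_eq_empty,
      Finset.prod_empty]
    rw [← (Equiv.funUnique (Fin 1) X).symm.sum_comp]
    simp [Equiv.funUnique, ite_and]
  | succ N ih =>
    rw [List.ofFn_succ, List.prod_cons, Matrix.mul_apply,
      ← (Fin.consEquiv fun _ : Fin (N + 2) => X).sum_comp, Fintype.sum_prod_type]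
    simp only [ih, Finset.mul_sum, Fin.consEquiv_apply, Fin.cons_zero, Fin.prod_univ_succ,
      ite_and, mul_ite, mul_zero, ← Fin.succ_last, Fin.cons_succ, Fin.castSucc_zero,
      ← Fin.succ_castSucc]
    rw [Finset.sum_comm (s := (Finset.univ : Finset X))
        (t := (Finset.univ : Finset (Fin (N + 1) → X))),
      Finset.sum_comm (s := (Finset.univ : Finset X))
        (t := (Finset.univ : Finset (Fin (N + 1) → X)))]
    refine Finset.sum_congr rfl fun σ _ => ?_
    simp

theorem Matrix.trace_diagonal_mul_prod_ofFn {N : ℕ} (F : X → R) (O : Fin N → Matrix X X R) :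
    (diagonal F * (List.ofFn O).prod).trace = ∑ σ : Fin (N + 1) → X,
      if σ 0 = σ (Fin.last N) then F (σ 0) * ∏ k : Fin N, O k (σ k.castSucc) (σ k.succ) else 0 := by
  simp only [Matrix.trace, diag_apply, diagonal_mul, prod_ofFn_apply, Finset.mul_sum]
  rw [Finset.sum_comm]
  refine Finset.sum_congr rfl fun σ _ => ?_
  simp [ite_and, eq_comm]

theorem pow_sum_smul {A : Type*} [Ring A] [Algebra R A] (w : I → R) (O : I → A) (N : ℕ) :
    (∑ i, w i • O i) ^ N = ∑ a : Fin N → I, (∏ k, w (a k)) • (List.ofFn fun k => O (a k)).prod := by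
  induction N with
  | zero => simp
  | succ N ih =>
    rw [pow_succ', ih, ← (Fin.consEquiv fun _ : Fin (N + 1) => I).sum_comp, Fintype.sum_prod_type,
      Finset.sum_mul_sum]
    refine Finset.sum_congr rfl fun i _ => Finset.sum_congr rfl fun a _ => ?_
    simp [Fin.prod_univ_succ, mul_smul, List.ofFn_succ]
    rw [smul_comm]

end MatrixExpansion

/-! ### Feynman–Kac expansion of the Gibbs trace -/

namespace QuantumSpin

open Matrix RandomLoops

variable {Λ : Type*} [Fintype Λ] [DecidableEq Λ] {G : SimpleGraph Λ} {n : ℕ}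

/-- The rate of a transition: `u` for crosses and `1 - u` for double bars. -/
noncomputable def rate (u : ℝ) (a : G.edgeSet × Bool) : ℝ := if a.2 = true then u else 1 - u

open Classical in
/-- The operator of a transition, `T` for crosses and `Q` for double bars. -/
noncomputable def transitionOp (n : ℕ) (a : G.edgeSet × Bool) :
    Matrix (Λ → Fin (n + 1)) (Λ → Fin (n + 1)) ℂ :=
  fun σ τ => if Compat a σ τ then 1 else 0

theorem lift_interaction_eq (u : ℝ) (e : G.edgeSet) :
    Sym2.lift ⟨interaction n u, interaction_comm n u⟩ (e : Sym2 Λ) =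
      ∑ b : Bool, (rate u (e, b) : ℂ) • transitionOp n (e, b) - 1 := by
  obtain ⟨e, he⟩ := e
  induction e with
  | _ x y =>
  have c : ∀ (b : Bool) (σ τ : Λ → Fin (n + 1)), Compat (⟨s(x, y), he⟩, b) σ τ ↔
      (∀ z, z ≠ x → z ≠ y → σ z = τ z) ∧ (b = true → σ x = τ y ∧ σ y = τ x) ∧
        (b ≠ true → σ x = σ y ∧ τ x = τ y) := by
    intro b σ τ
    simp only [Compat, Sym2.mem_iff, not_or, and_imp, Sym2.eq_iff]
    refine and_congr_right fun _ => ⟨fun h => ?_, fun h v w => ?_⟩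
    · exact ⟨fun hb => ⟨(h x y (Or.inl ⟨rfl, rfl⟩)).1 hb, (h y x (Or.inr ⟨rfl, rfl⟩)).1 hb⟩,
        (h x y (Or.inl ⟨rfl, rfl⟩)).2⟩
    · rintro (⟨rfl, rfl⟩ | ⟨rfl, rfl⟩)
      · exact ⟨fun hb => (h.1 hb).1, h.2⟩
      · exact ⟨fun hb => (h.1 hb).2, fun hb => ⟨(h.2 hb).1.symm, (h.2 hb).2.symm⟩⟩
  have hT : transitionOp n (⟨s(x, y), he⟩, true) = twoSite x y (T n) := by
    ext σ τ
    simp [transitionOp, c, twoSite, T, ite_and]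
  have hQ : transitionOp n (⟨s(x, y), he⟩, false) = twoSite x y (Q n) := by
    ext σ τ
    simp [transitionOp, c, twoSite, Q, ite_and]
  simp only [Sym2.lift_mk, interaction, hT, hQ, rate, Fintype.sum_bool, if_true,
    Bool.false_eq_true, if_false]

theorem hamiltonian_eq [DecidableRel G.Adj] (u : ℝ) :
    hamiltonian G n u = ((Fintype.card G.edgeSet : ℝ) : ℂ) • 1 -
      ∑ a : G.edgeSet × Bool, (rate u a : ℂ) • transitionOp n a := by
  have : ∑ e ∈ G.edgeFinset, Sym2.lift ⟨interaction n u, interaction_comm n u⟩ e =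
      ∑ e : G.edgeSet, Sym2.lift ⟨interaction n u, interaction_comm n u⟩ (e : Sym2 Λ) :=
    Finset.sum_subtype _ (fun e => SimpleGraph.mem_edgeFinset) _
  rw [hamiltonian, this]
  simp only [lift_interaction_eq, Finset.sum_sub_distrib, Fintype.sum_prod_type]
  rw [neg_sub]
  congr 1
  simp [Nat.cast_smul_eq_nsmul]

theorem trace_diagonal_mul_prod_transitionOp (F : (Λ → Fin (n + 1)) → ℝ) {N : ℕ}
    (a : Fin N → G.edgeSet × Bool) :
    (diagonal (fun σ => (F σ : ℂ)) * (List.ofFn fun k => transitionOp n (a k)).prod).trace =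
      (pathSum F a : ℂ) := by
  classical
  rw [Matrix.trace_diagonal_mul_prod_ofFn, pathSum]
  push_cast
  refine Finset.sum_congr rfl fun σ _ => ?_
  simp only [transitionOp, IsClosedPath, Finset.prod_ite_zero, Finset.mem_univ, forall_const,
    Finset.prod_const_one]
  by_cases h1 : σ 0 = σ (Fin.last N) <;>
    by_cases h2 : ∀ k, Compat (a k) (σ k.castSucc) (σ k.succ) <;> simp [h1, h2]

attribute [local instance] Matrix.linftyOpNormedAddCommGroup Matrix.linftyOpNormedSpace
  Matrix.linftyOpNormedRing Matrix.linftyOpNormedAlgebra in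
theorem hasSum_trace_mul_exp {X : Type*} [Fintype X] [DecidableEq X] (D M : Matrix X X ℂ) :
    HasSum (fun N : ℕ => ((N.factorial : ℂ)⁻¹) * (D * M ^ N).trace)
      (D * NormedSpace.exp M).trace := by
  have h := NormedSpace.exp_series_hasSum_exp' (𝕂 := ℂ) M
  let l : Matrix X X ℂ →ₗ[ℂ] ℂ := Matrix.traceLinearMap X ℂ ℂ ∘ₗ LinearMap.mulLeft ℂ D
  have := (LinearMap.toContinuousLinearMap l).hasSum h
  simp only [map_smul, smul_eq_mul] at this
  exact this

/-- The Feynman-Kac expansion of the Gibbs trace. -/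
theorem hasSum_trace_diagonal_mul_exp [DecidableRel G.Adj] (u β : ℝ)
    (F : (Λ → Fin (n + 1)) → ℝ) :
    HasSum (fun N : ℕ => ((Real.exp (-(β * Fintype.card G.edgeSet)) * (β ^ N / N.factorial *
        ∑ a : Fin N → G.edgeSet × Bool, (∏ k, rate u (a k)) * pathSum F a) : ℝ) : ℂ))
      (diagonal (fun σ => (F σ : ℂ)) *
        NormedSpace.exp (-((β : ℂ) • hamiltonian G n u))).trace := by
  set M := ∑ a : G.edgeSet × Bool, (rate u a : ℂ) • transitionOp n a with hM
  have e1 : -((β : ℂ) • hamiltonian G n u) =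
      ((-(β * Fintype.card G.edgeSet) : ℝ) : ℂ) • (1 : Matrix _ _ ℂ) + (β : ℂ) • M := by
    rw [hamiltonian_eq, ← hM, smul_sub, smul_smul]
    push_cast
    module
  -- The constant `-1` on each edge becomes the normalization `e^{-β|ℰ|}` of the Poisson process.
  have e2 : NormedSpace.exp (-((β : ℂ) • hamiltonian G n u)) =
      (Real.exp (-(β * Fintype.card G.edgeSet)) : ℂ) • NormedSpace.exp ((β : ℂ) • M) := by
    rw [e1, Matrix.exp_add_of_commute _ _ ((Commute.one_left _).smul_left _)]
    have : NormedSpace.exp (((-(β * Fintype.card G.edgeSet) : ℝ) : ℂ) •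
        (1 : Matrix (Λ → Fin (n + 1)) (Λ → Fin (n + 1)) ℂ)) =
        (Real.exp (-(β * Fintype.card G.edgeSet)) : ℂ) • 1 := by
      rw [← diagonal_one, ← diagonal_smul, Matrix.exp_diagonal, ← diagonal_smul]
      congr 1
      ext i
      simp [Pi.coe_exp, Complex.exp_eq_exp_ℂ]
    rw [this, smul_mul_assoc, one_mul]
  rw [e2, mul_smul_comm, trace_smul, smul_eq_mul]
  have key := (hasSum_trace_mul_exp (diagonal fun σ => (F σ : ℂ)) ((β : ℂ) • M)).mul_left
    (Real.exp (-(β * Fintype.card G.edgeSet)) : ℂ)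
  refine Eq.mp (congrArg (fun g => HasSum g _ _) (funext fun N => ?_)) key
  symm
  rw [smul_pow, hM, pow_sum_smul, mul_smul_comm, trace_smul]
  simp only [Finset.mul_sum, trace_sum, mul_smul_comm, trace_smul,
    trace_diagonal_mul_prod_transitionOp, smul_eq_mul]
  push_cast
  refine Finset.sum_congr rfl fun a _ => ?_
  ring

end QuantumSpin

/-! ### Integration against the Poisson process -/

theorem measurableEmbedding_sigmaMk {ι : Type*} {M : ι → Type*} [∀ i, MeasurableSpace (M i)]
    (i : ι) : MeasurableEmbedding (Sigma.mk i : M i → Σ i, M i) where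
  injective := sigma_mk_injective
  measurable := Measurable.of_le_map (iInf_le _ i)
  measurableSet_image' := by
    intro s hs
    refine MeasurableSpace.measurableSet_iInf.2 fun j => ?_
    change MeasurableSet (Sigma.mk j ⁻¹' (Sigma.mk i '' s))
    by_cases h : j = i
    · subst h
      rwa [preimage_image_eq _ sigma_mk_injective]
    · convert! MeasurableSet.empty
      ext y
      simp only [mem_preimage, mem_image, mem_empty_iff_false, iff_false]
      rintro ⟨z, -, hz⟩
      exact h (congrArg Sigma.fst hz).symm

theorem measurable_sigma {ι γ : Type*} {M : ι → Type*} [∀ i, MeasurableSpace (M i)]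
    [MeasurableSpace γ] {g : (Σ i, M i) → γ} (h : ∀ i, Measurable fun p => g ⟨i, p⟩) :
    Measurable g :=
  fun _ hs => MeasurableSpace.measurableSet_iInf.2 fun i => h i hs

section Poisson

variable {M : Type*} [MeasurableSpace M] (ν : Measure M)

/-- Each sector embeds measurably, so the formula holds for arbitrary `g`, measurable or not. -/
theorem lintegral_poissonProcess (g : (Σ n : ℕ, (Fin n → M)) → ENNReal) :
    ∫⁻ ω, g ω ∂(poissonProcess ν) = ENNReal.ofReal (Real.exp (-(ν.real univ))) *
      ∑' N : ℕ, (Nat.factorial N : ENNReal)⁻¹ *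
        ∫⁻ p, g ⟨N, p⟩ ∂(Measure.pi fun _ : Fin N => ν) := by
  rw [poissonProcess, lintegral_smul_measure, lintegral_sum_measure, smul_eq_mul]
  congr 2
  funext N
  rw [lintegral_smul_measure, (measurableEmbedding_sigmaMk N).lintegral_map, smul_eq_mul]

theorem ae_poissonProcess {P : (Σ n : ℕ, (Fin n → M)) → Prop}
    (h : ∀ N, ∀ᵐ p ∂(Measure.pi fun _ : Fin N => ν), P ⟨N, p⟩) : ∀ᵐ ω ∂(poissonProcess ν), P ω := by
  refine Measure.ae_smul_measure (Measure.ae_sum_iff.2 fun N => ?_) _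
  exact Measure.ae_smul_measure ((measurableEmbedding_sigmaMk N).ae_map_iff.2 (h N)) _

instance [SigmaFinite ν] : SFinite (poissonProcess ν) := by
  unfold poissonProcess
  infer_instance

end Poisson

/-! ### Separation of times and marks, and time ordering -/

namespace RandomLoops

open QuantumSpin

variable {Λ : Type*} {G : SimpleGraph Λ} {n : ℕ}

/-- The distribution of the kinds of transitions. -/
noncomputable def kindMeasure (u : ℝ) : Measure Bool :=
  ENNReal.ofReal u • Measure.dirac true + ENNReal.ofReal (1 - u) • Measure.dirac false

instance (u : ℝ) : IsFiniteMeasure (kindMeasure u) := by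
  unfold kindMeasure
  have := (Measure.dirac true).smul_finite (c := ENNReal.ofReal u) ENNReal.ofReal_ne_top
  have := (Measure.dirac false).smul_finite (c := ENNReal.ofReal (1 - u)) ENNReal.ofReal_ne_top
  infer_instance

theorem intensity_eq (u β : ℝ) : intensity G u β =
    (Measure.count : Measure G.edgeSet).prod ((kindMeasure u).prod (volume.restrict (Icc 0 β))) :=
  rfl

/-- Separation of the marks and the times of `N` transitions. -/
def splitTimes (G : SimpleGraph Λ) (N : ℕ) :
    (Fin N → G.edgeSet × Bool) × (Fin N → ℝ) ≃ᵐ (Fin N → Transition G) :=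
  (MeasurableEquiv.arrowProdEquivProdArrow (G.edgeSet × Bool) ℝ (Fin N)).symm.trans
    (MeasurableEquiv.piCongrRight fun _ => MeasurableEquiv.prodAssoc)

theorem splitTimes_apply (N : ℕ) (q : (Fin N → G.edgeSet × Bool) × (Fin N → ℝ)) (k : Fin N) :
    splitTimes G N q k = ((q.1 k).1, (q.1 k).2, q.2 k) := rfl

variable [Finite G.edgeSet]

instance : IsFiniteMeasure (Measure.count : Measure G.edgeSet) :=
  ⟨by
    rw [Measure.count_apply MeasurableSet.univ]
    simpa using Set.toFinite G.edgeSet⟩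

instance (u β : ℝ) : IsFiniteMeasure (intensity G u β) := by
  rw [intensity_eq]; infer_instance

omit [Finite G.edgeSet] in
theorem intensity_real_univ [Fintype G.edgeSet] {u β : ℝ} (hu : u ∈ Icc (0 : ℝ) 1) (hβ : 0 ≤ β) :
    (intensity G u β).real univ = β * Fintype.card G.edgeSet := by
  rw [intensity_eq, ← univ_prod_univ, measureReal_prod_prod, ← univ_prod_univ,
    measureReal_prod_prod]
  have h1 : (kindMeasure u).real univ = 1 := by
    simp only [kindMeasure, Measure.real, Measure.add_apply, Measure.smul_apply, measure_univ,
      smul_eq_mul, mul_one]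
    rw [← ENNReal.ofReal_add hu.1 (sub_nonneg.2 hu.2)]
    simp
  have h2 : (Measure.count : Measure G.edgeSet).real univ = Fintype.card G.edgeSet := by
    rw [Measure.real, Measure.count_apply MeasurableSet.univ, Set.encard_univ,
      ENat.card_eq_coe_fintype_card, ENat.toENNReal_coe, ENNReal.toReal_natCast]
  rw [h1, h2]
  simp [hβ, mul_comm]

theorem measurePreserving_splitTimes (u β : ℝ) (N : ℕ) :
    MeasurePreserving (splitTimes G N)
      ((Measure.pi fun _ : Fin N => (Measure.count : Measure G.edgeSet).prod (kindMeasure u)).prod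
        (Measure.pi fun _ : Fin N => volume.restrict (Icc 0 β)))
      (Measure.pi fun _ => intensity G u β) := by
  have h1 := measurePreserving_pi (ι := Fin N) _ _ fun _ => measurePreserving_prodAssoc
    (Measure.count : Measure G.edgeSet) (kindMeasure u) (volume.restrict (Icc 0 β))
  have h2 := (measurePreserving_arrowProdEquivProdArrow (G.edgeSet × Bool) ℝ (Fin N)
    (fun _ => (Measure.count : Measure G.edgeSet).prod (kindMeasure u))
    (fun _ => volume.restrict (Icc 0 β))).symm
  exact h1.comp h2

theorem ae_times {β : ℝ} (N : ℕ) :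
    ∀ᵐ t ∂(Measure.pi fun _ : Fin N => (volume : Measure ℝ).restrict (Icc 0 β)),
      (∀ i, t i ∈ Ioo 0 β) ∧ Function.Injective t := by
  refine Filter.Eventually.and ?_ ?_
  · rw [ae_all_iff]
    intro i
    refine (Measure.quasiMeasurePreserving_eval
      (fun _ : Fin N => (volume : Measure ℝ).restrict (Icc 0 β)) i).ae
      (p := fun s : ℝ => s ∈ Ioo 0 β) ?_
    rw [← Measure.restrict_congr_set Ioo_ae_eq_Icc]
    exact ae_restrict_mem measurableSet_Ioo
  -- Coincidences of times lie in finitely many proper subspaces `t i = t j`, which are Lebesgue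
  -- null.
  · have hac : (Measure.pi fun _ : Fin N => (volume : Measure ℝ).restrict (Icc 0 β)) ≪ volume := by
      rw [← Measure.restrict_pi_pi]
      exact Measure.absolutelyContinuous_of_le Measure.restrict_le_self
    refine hac.ae_le ?_
    have : ∀ i j : Fin N, i ≠ j → ∀ᵐ t : Fin N → ℝ, t i ≠ t j := by
      intro i j hij
      let p : Submodule ℝ (Fin N → ℝ) :=
        LinearMap.ker (LinearMap.proj (R := ℝ) (φ := fun _ : Fin N => ℝ) i - LinearMap.proj j)
      have hp : p ≠ ⊤ := by
        intro h
        have : Pi.single i (1 : ℝ) ∈ p := h ▸ Submodule.mem_top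
        simp [p, hij] at this
      have := Measure.addHaar_submodule volume p hp
      rw [ae_iff]
      convert this using 2
      ext t
      simp [p, sub_eq_zero]
    have h2 : ∀ᵐ t : Fin N → ℝ, ∀ i j, i ≠ j → t i ≠ t j := by
      refine ae_all_iff.2 fun i => ae_all_iff.2 fun j => ?_
      by_cases h : i = j
      · simp [h]
      · filter_upwards [this i j h] with t ht _ using ht
    filter_upwards [h2] with t ht i j hij
    by_contra h
    exact ht i j h hij

/-- Almost surely the transitions occur at distinct times inside `(0,β)`. -/
theorem ae_isSorted (u β : ℝ) : ∀ᵐ ω ∂(rho G u β), ω.IsSorted β (Tuple.sort ω.time) := by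
  refine ae_poissonProcess _ fun N => ?_
  rw [← (measurePreserving_splitTimes u β N).map_eq,
    (splitTimes G N).measurableEmbedding.ae_map_iff]
  filter_upwards [Measure.quasiMeasurePreserving_snd.ae (ae_times (β := β) N)] with q hq
  have ht : Config.time (⟨N, splitTimes G N q⟩ : Config G) = q.2 := rfl
  refine ⟨(Tuple.monotone_sort _).strictMono_of_injective ?_, hq.1⟩
  rw [ht]
  exact hq.2.comp (Equiv.injective _)

theorem measurable_sort (N : ℕ) (k : Fin N) :
    Measurable fun t : Fin N → ℝ => Tuple.sort t k := by
  let _ : MeasurableSpace (Equiv.Perm (Fin N)) := ⊤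
  have h : Measurable fun t : Fin N → ℝ => Tuple.sort t := by
    refine measurable_to_countable' fun σ => ?_
    have : (fun t : Fin N → ℝ => Tuple.sort t) ⁻¹' {σ} =
        {t | (∀ i j, i ≤ j → t (σ i) ≤ t (σ j)) ∧
          ∀ i j, i < j → t (σ i) = t (σ j) → σ i < σ j} := by
      ext t
      rw [mem_preimage, mem_singleton_iff, eq_comm, Tuple.eq_sort_iff]
      rfl
    rw [this]
    measurability
  exact (measurable_from_top (f := fun σ : Equiv.Perm (Fin N) => σ k)).comp h

omit [Finite G.edgeSet] in
theorem measurable_marks_sort (N : ℕ) : Measurable fun (p : Fin N → Transition G) (k : Fin N) =>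
    Config.marks (⟨N, p⟩ : Config G) (Tuple.sort (Config.time ⟨N, p⟩)) k := by
  refine measurable_pi_iff.2 fun k => ?_
  have h1 : Measurable fun q : Fin N × (Fin N → Transition G) => ((q.2 q.1).1, (q.2 q.1).2.1) :=
    measurable_from_prod_countable_right fun i => by fun_prop
  have h2 : Measurable fun p : Fin N → Transition G => Tuple.sort (fun i => (p i).2.2) k :=
    (measurable_sort N k).comp (measurable_pi_iff.2 fun i => by fun_prop)
  exact h1.comp (h2.prodMk measurable_id)

/-- Integration against the Poisson measure of a function of the time-ordered sequence of marks. -/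
theorem lintegral_rho_marks [Fintype G.edgeSet] {u β : ℝ} (hu : u ∈ Icc (0 : ℝ) 1) (hβ : 0 ≤ β)
    (F : ∀ N, (Fin N → G.edgeSet × Bool) → ENNReal) :
    ∫⁻ ω, F ω.1 (ω.marks (Tuple.sort ω.time)) ∂(rho G u β) =
      ENNReal.ofReal (Real.exp (-(β * Fintype.card G.edgeSet))) * ∑' N : ℕ,
        (Nat.factorial N : ENNReal)⁻¹ * (ENNReal.ofReal β ^ N *
          ∑ a : Fin N → G.edgeSet × Bool, (∏ k, ENNReal.ofReal (rate u (a k))) * F N a) := by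
  rw [rho, lintegral_poissonProcess, intensity_real_univ hu hβ]
  congr 3
  funext N
  congr 1
  have hm : Measurable fun p : Fin N → Transition G =>
      F N (Config.marks (⟨N, p⟩ : Config G) (Tuple.sort (Config.time ⟨N, p⟩))) :=
    (Measurable.of_discrete (f := F N)).comp (measurable_marks_sort N)
  rw [← (measurePreserving_splitTimes u β N).lintegral_comp_emb
    (splitTimes G N).measurableEmbedding]
  refine (lintegral_prod_symm' _ (hm.comp (splitTimes G N).measurable)).trans ?_
  have hkind : ∀ a : G.edgeSet × Bool,
      ((Measure.count : Measure G.edgeSet).prod (kindMeasure u)) {a} =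
        ENNReal.ofReal (rate u a) := by
    rintro ⟨e, b⟩
    rw [← singleton_prod_singleton, Measure.prod_prod]
    cases b <;> simp [kindMeasure, rate]
  -- For fixed times, sorting merely permutes the marks, and the product weight is invariant under
  -- permutations. The integral over marks is therefore independent of `t`, and the times contribute
  -- only `β ^ N`.
  have hin : ∀ t : Fin N → ℝ,
      ∫⁻ a, F N (Config.marks (⟨N, splitTimes G N (a, t)⟩ : Config G)
        (Tuple.sort (Config.time ⟨N, splitTimes G N (a, t)⟩)))
        ∂(Measure.pi fun _ : Fin N => (Measure.count : Measure G.edgeSet).prod (kindMeasure u)) =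
      ∑ a : Fin N → G.edgeSet × Bool, (∏ k, ENNReal.ofReal (rate u (a k))) * F N a := by
    intro t
    rw [lintegral_fintype, ← (Equiv.arrowCongr (Tuple.sort t) (Equiv.refl _)).sum_comp]
    refine Finset.sum_congr rfl fun a _ => ?_
    rw [Measure.pi_singleton, mul_comm]
    congr 1
    · rw [← Equiv.prod_comp (Tuple.sort t)]
      simp [hkind]
    · congr 1
      funext k
      have : Config.time (⟨N, splitTimes G N ((Equiv.arrowCongr (Tuple.sort t)
        (Equiv.refl (G.edgeSet × Bool))) a, t)⟩ : Config G) = t := rfl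
      simp [Config.marks, splitTimes_apply, this]
  refine (lintegral_congr hin).trans ?_
  rw [lintegral_const, mul_comm]
  congr 1
  rw [Measure.pi_univ]
  simp

end RandomLoops

/-! ### Gibbs traces and loop probabilities -/

namespace RandomLoops

open QuantumSpin Matrix

variable {Λ : Type*} [Fintype Λ] {G : SimpleGraph Λ} {n : ℕ}

/-- Gibbs traces of diagonal observables as integrals over the Poisson process. -/
theorem trace_eq_lintegral [DecidableEq Λ] [DecidableRel G.Adj] {u β : ℝ} (hu : u ∈ Icc (0 : ℝ) 1)
    (hβ : 0 ≤ β) {F : (Λ → Fin (n + 1)) → ℝ}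
    (hF : ∀ N (a : Fin N → G.edgeSet × Bool), 0 ≤ pathSum F a) :
    ((∫⁻ ω, ENNReal.ofReal (pathSum F (ω.marks (Tuple.sort ω.time))) ∂(rho G u β)).toReal : ℂ) =
      (diagonal (fun σ => (F σ : ℂ)) *
        NormedSpace.exp (-((β : ℂ) • hamiltonian G n u))).trace := by
  have h := hasSum_trace_diagonal_mul_exp (G := G) u β F
  set z := (diagonal (fun σ => (F σ : ℂ)) *
        NormedSpace.exp (-((β : ℂ) • hamiltonian G n u))).trace
  have hre := Complex.hasSum_re h
  simp only [Complex.ofReal_re] at hre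
  -- The trace is real because every term of its expansion is.
  have hz : z = (z.re : ℂ) := h.unique (Complex.hasSum_ofReal.2 hre)
  have hrate : ∀ a : G.edgeSet × Bool, 0 ≤ rate u a := fun a => by
    unfold rate; split_ifs <;> linarith [hu.1, hu.2]
  have h0 : ∀ N, 0 ≤ ∑ a : Fin N → G.edgeSet × Bool, (∏ k, rate u (a k)) * pathSum F a := fun N =>
    Finset.sum_nonneg fun a _ => mul_nonneg (Finset.prod_nonneg fun k _ => hrate _) (hF N a)
  have hterm : ∀ N : ℕ, 0 ≤ Real.exp (-(β * Fintype.card G.edgeSet)) * (β ^ N / N.factorial *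
        ∑ a : Fin N → G.edgeSet × Bool, (∏ k, rate u (a k)) * pathSum F a) := fun N => by
    have := h0 N
    positivity
  have key : ∫⁻ ω, ENNReal.ofReal (pathSum F (ω.marks (Tuple.sort ω.time))) ∂(rho G u β) =
      ENNReal.ofReal z.re := by
    rw [lintegral_rho_marks hu hβ (fun N a => ENNReal.ofReal (pathSum F a)), ← hre.tsum_eq,
      ENNReal.ofReal_tsum_of_nonneg hterm hre.summable, ← ENNReal.tsum_mul_left]
    congr 1
    funext N
    rw [ENNReal.ofReal_mul (Real.exp_pos _).le, ENNReal.ofReal_mul (by positivity),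
      ENNReal.ofReal_sum_of_nonneg
        fun a _ => mul_nonneg (Finset.prod_nonneg fun k _ => hrate _) (hF N a),
      ENNReal.ofReal_div_of_pos (by positivity), ENNReal.ofReal_pow hβ, ENNReal.ofReal_natCast,
      div_eq_mul_inv, mul_comm (_ ^ N) (_⁻¹), mul_assoc]
    congr 3
    refine Finset.sum_congr rfl fun a _ => ?_
    rw [ENNReal.ofReal_mul (Finset.prod_nonneg fun k _ => hrate _),
      ENNReal.ofReal_prod_of_nonneg fun k _ => hrate _]
  have hz0 : 0 ≤ z.re := hre.tsum_eq ▸ tsum_nonneg hterm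
  rw [key, ENNReal.toReal_ofReal hz0, ← hz]

theorem partitionFunction_eq [DecidableEq Λ] (u : ℝ) {β : ℝ} (hβ : 0 ≤ β) :
    partitionFunction G u β ((n : ℝ) + 1) =
      ∫⁻ ω, ENNReal.ofReal (pathSum (n := n) (fun _ => 1) (ω.marks (Tuple.sort ω.time)))
        ∂(rho G u β) := by
  classical
  refine lintegral_congr_ae ?_
  filter_upwards [ae_isSorted (G := G) u β] with ω hω
  rw [hω.pathSum_one hβ, ENNReal.ofReal_pow (by positivity)]

/-- Almost surely the path sum of `f(σ_x) f(σ_y)` equals `(∑ f²) / θ` times `θ^{|ℒ|}` on the event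
and vanishes off it. -/
theorem setLIntegral_sameLoop [DecidableEq Λ] (u : ℝ) {β : ℝ} (hβ : 0 ≤ β) {f : Fin (n + 1) → ℝ}
    (hf : ∑ v, f v = 0) (hf2 : 0 < ∑ v, f v ^ 2) (x y : Λ) :
    ∫⁻ ω in sameLoop G β x y 0, ENNReal.ofReal ((n : ℝ) + 1) ^ ω.numLoops β ∂(rho G u β) =
      ENNReal.ofReal (((n : ℝ) + 1) / ∑ v, f v ^ 2) *
        ∫⁻ ω, ENNReal.ofReal (pathSum (fun σ => f (σ x) * f (σ y))
          (ω.marks (Tuple.sort ω.time))) ∂(rho G u β) := by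
  classical
  set W : Config G → ℝ := fun ω =>
    pathSum (fun σ => f (σ x) * f (σ y)) (ω.marks (Tuple.sort ω.time)) with hW
  have hWm : Measurable W := measurable_sigma fun N =>
    (Measurable.of_discrete (f := fun a : Fin N → G.edgeSet × Bool =>
      pathSum (fun σ => f (σ x) * f (σ y)) a)).comp (measurable_marks_sort N)
  have hn : (0 : ℝ) < (n : ℝ) + 1 := by positivity
  have hS : MeasurableSet {ω | W ω ≠ 0} := hWm (measurableSet_singleton 0).compl
  have hae : ∀ᵐ ω ∂(rho G u β), ((n : ℝ) + 1) * W ω =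
      if ω ∈ sameLoop G β x y 0 then (∑ v, f v ^ 2) * ((n : ℝ) + 1) ^ ω.numLoops β else 0 := by
    filter_upwards [ae_isSorted (G := G) u β] with ω hω
    exact hω.pathSum_mul hβ hf x y
  -- The event is not shown to be measurable directly; it is replaced by the almost surely equal set
  -- where the measurable path sum `W` is nonzero.
  have hset : sameLoop G β x y 0 =ᵐ[rho G u β] {ω | W ω ≠ 0} := by
    rw [Filter.eventuallyEq_set]
    filter_upwards [hae] with ω hω
    constructor
    · intro h
      rw [if_pos h] at hω
      intro h0
      rw [h0, mul_zero] at hω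
      exact (by positivity : (∑ v, f v ^ 2) * ((n : ℝ) + 1) ^ ω.numLoops β ≠ 0) hω.symm
    · intro h
      by_contra h'
      rw [if_neg h'] at hω
      exact (mul_ne_zero hn.ne' h) hω
  rw [setLIntegral_congr hset, ← lintegral_indicator hS,
    ← lintegral_const_mul' _ _ ENNReal.ofReal_ne_top]
  refine lintegral_congr_ae ?_
  filter_upwards [hae, Filter.eventuallyEq_set.1 hset] with ω h1 h2
  by_cases h : ω ∈ sameLoop G β x y 0
  · rw [indicator_of_mem (h2.1 h), ← ENNReal.ofReal_mul (by positivity),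
      ← ENNReal.ofReal_pow hn.le]
    rw [if_pos h] at h1
    congr 1
    rw [div_mul_eq_mul_div]
    change _ = ((n : ℝ) + 1) * W ω / _
    rw [h1]
    field_simp
  · have h0 : W ω = 0 := by
      by_contra h3
      exact h (h2.2 h3)
    rw [indicator_of_notMem (by simpa using h0)]
    change _ = _ * ENNReal.ofReal (W ω)
    simp [h0]

/-- Since `rho` is s-finite, the density formula holds for sets that need not be measurable. -/
theorem loopMeasure_real_apply (u β θ : ℝ) (s : Set (Config G)) :
    (loopMeasure G u β θ).real s = (partitionFunction G u β θ).toReal⁻¹ *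
      (∫⁻ ω in s, ENNReal.ofReal θ ^ ω.numLoops β ∂(rho G u β)).toReal := by
  have : SFinite (rho G u β) := by unfold rho; infer_instance
  rw [loopMeasure, Measure.real, Measure.smul_apply, withDensity_apply', smul_eq_mul,
    ENNReal.toReal_mul, ENNReal.toReal_inv]

theorem loopMeasure_real_le_one (u β θ : ℝ) (s : Set (Config G)) :
    (loopMeasure G u β θ).real s ≤ 1 := by
  have : SFinite (rho G u β) := by unfold rho; infer_instance
  refine ENNReal.toReal_le_of_le_ofReal zero_le_one ?_
  rw [loopMeasure, Measure.smul_apply, withDensity_apply', smul_eq_mul, ENNReal.ofReal_one]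
  refine le_trans (mul_le_mul_right ?_ _) (ENNReal.inv_mul_le_one (partitionFunction G u β θ))
  exact setLIntegral_le_lintegral _ _

omit [Fintype Λ] in
theorem reachable_of_step {ω : Config G} {β : ℝ} {p q : Λ × ℝ} (h : Config.Step ω β p q) :
    G.Reachable p.1 q.1 := by
  have adj : ∀ {x y : Λ} {i : Fin ω.1}, ω.edge i = s(x, y) → G.Reachable x y := by
    intro x y i he
    have := (ω.2 i).1.2
    have he' : ((ω.2 i).1 : Sym2 Λ) = s(x, y) := he
    rw [he'] at this
    exact SimpleGraph.Adj.reachable this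
  cases h with
  | vertical _ _ => rfl
  | period => rfl
  | cross he _ _ _ _ _ => exact adj he
  | barBelow he _ _ _ _ _ => exact adj he
  | barAbove he _ _ _ _ _ => exact adj he

omit [Fintype Λ] in
theorem sameLoop_eq_empty {β : ℝ} {x y : Λ} (h : ¬ G.Reachable x y) (t : ℝ) :
    sameLoop G β x y t = ∅ := by
  refine eq_empty_of_forall_notMem fun ω ⟨hx, hy, he⟩ => h ?_
  have key : ∀ p q : ω.points β,
      Relation.EqvGen (fun p q : ω.points β => Config.Step ω β p.1 q.1) p q →
        G.Reachable p.1.1 q.1.1 := by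
    intro p q hpq
    induction hpq with
    | rel p q hs => exact reachable_of_step hs
    | refl p => rfl
    | symm p q _ ih => exact ih.symm
    | trans p q r _ _ ih1 ih2 => exact ih1.trans ih2
  exact key _ _ (Quotient.exact he)

end RandomLoops

/-! ### Correlations, loop probabilities and logarithmic decay -/

namespace QuantumSpin

open RandomLoops Matrix

variable {Λ : Type*} [Fintype Λ] {G : SimpleGraph Λ} {n : ℕ}

theorem oneSite_diagonal [DecidableEq Λ] (x : Λ) (f : Fin (n + 1) → ℂ) :
    oneSite x (diagonal f) = diagonal fun σ : Λ → Fin (n + 1) => f (σ x) := by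
  ext σ τ
  simp only [oneSite, diagonal_apply]
  by_cases h : σ = τ
  · subst h; simp
  · rw [if_neg h]
    split_ifs with h1 h2
    · refine absurd (funext fun z => ?_) h
      by_cases hz : z = x
      · rw [hz, h2]
      · exact h1 z hz
    · rfl
    · rfl

/-- Correlations of traceless diagonal observables in terms of random loops. -/
theorem gibbs_diagonal_mul_diagonal [DecidableEq Λ] [DecidableRel G.Adj] {u β : ℝ}
    (hu : u ∈ Icc (0 : ℝ) 1) (hβ : 0 ≤ β) {f : Fin (n + 1) → ℝ} (hf : ∑ v, f v = 0)
    (hf2 : 0 < ∑ v, f v ^ 2) (x y : Λ) :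
    gibbs G n u β (oneSite x (diagonal fun v => (f v : ℂ)) *
      oneSite y (diagonal fun v => (f v : ℂ))) =
      (((∑ v, f v ^ 2) / ((n : ℝ) + 1) *
        (loopMeasure G u β ((n : ℝ) + 1)).real (sameLoop G β x y 0) : ℝ) : ℂ) := by
  have e1 := trace_eq_lintegral (G := G) hu hβ (F := fun σ => f (σ x) * f (σ y))
    fun N a => pathSum_mul_nonneg a hf x y
  have e2 := trace_eq_lintegral (G := G) (n := n) hu hβ (F := fun _ => 1)
    fun N a => pathSum_one_nonneg a
  rw [loopMeasure_real_apply, setLIntegral_sameLoop u hβ hf hf2, partitionFunction_eq u hβ, gibbs,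
    oneSite_diagonal, oneSite_diagonal, diagonal_mul_diagonal]
  push_cast at e1 e2 ⊢
  rw [diagonal_one, one_mul] at e2
  rw [← e1, ← e2, ENNReal.toReal_mul, ENNReal.toReal_ofReal (by positivity)]
  have hn : ((n : ℂ) + 1) ≠ 0 := by exact_mod_cast (Nat.succ_ne_zero n)
  have h2 : (∑ v, (f v : ℂ) ^ 2) ≠ 0 := by exact_mod_cast hf2.ne'
  push_cast
  field_simp

theorem sum_spin3 (n : ℕ) : ∑ a : Fin (n + 1), ((a : ℝ) - (n : ℝ) / 2) = 0 := by
  have key : ∀ (m : ℕ) (c : ℝ), ∑ i ∈ Finset.range m, ((i : ℝ) - c) = m * (m - 1) / 2 - m * c := by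
    intro m c
    induction m with
    | zero => simp
    | succ m ih => rw [Finset.sum_range_succ, ih]; push_cast; ring
  rw [Fin.sum_univ_eq_sum_range (fun i => (i : ℝ) - (n : ℝ) / 2) (n + 1), key]
  push_cast; ring

theorem sum_sq_spin3 (n : ℕ) : ∑ a : Fin (n + 1), ((a : ℝ) - (n : ℝ) / 2) ^ 2 =
    ((n : ℝ) + 1) * (n * (n + 2) / 12) := by
  have key : ∀ (m : ℕ) (c : ℝ), ∑ i ∈ Finset.range m, ((i : ℝ) - c) ^ 2 =
      m * (m - 1) * (2 * m - 1) / 6 - m * (m - 1) * c + m * c ^ 2 := by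
    intro m c
    induction m with
    | zero => simp
    | succ m ih => rw [Finset.sum_range_succ, ih]; push_cast; ring
  rw [Fin.sum_univ_eq_sum_range (fun i => ((i : ℝ) - (n : ℝ) / 2) ^ 2) (n + 1), key]
  push_cast; ring

theorem gibbs_spin3_mul_spin3 [DecidableEq Λ] [DecidableRel G.Adj] {u β : ℝ}
    (hu : u ∈ Icc (0 : ℝ) 1) (hβ : 0 ≤ β) (x y : Λ) :
    gibbs G n u β (oneSite x (spin3 n) * oneSite y (spin3 n)) =
      ((n * (n + 2) / 12 *
        (loopMeasure G u β ((n : ℝ) + 1)).real (sameLoop G β x y 0) : ℝ) : ℂ) := by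
  have hs : spin3 n = diagonal fun a : Fin (n + 1) => (((a : ℝ) - (n : ℝ) / 2 : ℝ) : ℂ) := by
    simp [spin3]
  rcases Nat.eq_zero_or_pos n with rfl | hn
  -- For spin zero `∑ f² = 0` and the general formula is unavailable, but both sides vanish.
  · have : spin3 0 = 0 := by
      rw [hs]
      ext a b
      simp [diagonal_apply]
    have h0 : oneSite x (0 : Matrix (Fin (0 + 1)) (Fin (0 + 1)) ℂ) = 0 := by
      ext σ τ; simp [oneSite]
    simp [this, h0, gibbs]
  · rw [hs, gibbs_diagonal_mul_diagonal hu hβ (sum_spin3 n), sum_sq_spin3]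
    · congr 2
      field_simp
    · rw [sum_sq_spin3]
      positivity

/-- Logarithmic decay of the probability that two sites belong to the same loop. -/
theorem loopMeasure_sameLoop_le {C u β : ℝ} (hu : u ∈ Icc (0 : ℝ) 1) (hβ : 0 ≤ β) (hn : 1 ≤ n)
    (h : Is2DLike G C) {x y : Λ} (hxy : x ≠ y) (hr : G.Reachable x y) :
    (loopMeasure G u β ((n : ℝ) + 1)).real (sameLoop G β x y 0) ≤
      (n + 1) / 2 * √(768 * β * (n + 3) * C ^ 2) / √(Real.log ((G.dist x y : ℝ) + 1)) := by
  classical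
  have hd : 1 ≤ G.dist x y := hr.pos_dist_of_ne hxy
  have hL : 0 < Real.log ((G.dist x y : ℝ) + 1) := Real.log_pos (by
    have : (1 : ℝ) ≤ G.dist x y := by exact_mod_cast hd
    linarith)
  obtain ⟨a, b, hab⟩ : ∃ a b : Fin (n + 1), a ≠ b := by
    refine ⟨0, Fin.last n, fun hab => ?_⟩
    have := congrArg Fin.val hab
    simp at this
    lia
  -- The cutoff is placed at `y`, so that `φ` goes from `1` at `x` to `0` at `y`.
  set φ := logProfile G x (G.dist x y)
  have hx : φ x = 1 := by simp [φ, logProfile]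
  have hy : φ y = 0 := by simp [φ, logProfile, hL.ne']
  have hE := sum_gradSq_logProfile_le h (h.nonneg_of_reachable hxy hr) x hd
  have hmw := sq_norm_trace_le_energy hu hβ G hxy hx hy hab
  dsimp only at hmw
  obtain ⟨f, hf⟩ : ∃ f : Fin (n + 1) → ℝ, f = Pi.single a 1 - Pi.single b 1 := ⟨_, rfl⟩
  have hD : (Matrix.single a a 1 - Matrix.single b b 1 : Matrix (Fin (n + 1)) (Fin (n + 1)) ℂ) =
      diagonal fun v => (f v : ℂ) := by
    rw [← diagonal_single, ← diagonal_single, diagonal_sub]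
    congr 1
    funext v
    by_cases h1 : v = a <;> by_cases h2 : v = b <;> simp [hf, h1, h2, hab, hab.symm]
  have hf0 : ∑ v, f v = 0 := by simp [hf]
  have hf2 : ∑ v, f v ^ 2 = 2 := by
    have : ∀ v, f v ^ 2 =
        (Pi.single a 1 : Fin (n + 1) → ℝ) v + (Pi.single b 1 : Fin (n + 1) → ℝ) v := by
      intro v
      by_cases h1 : v = a
      · subst h1; simp [hf, hab]
      · by_cases h2 : v = b
        · subst h2; simp [hf, hab.symm]
        · simp [hf, h1, h2]
    simp only [this, Finset.sum_add_distrib]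
    norm_num
  have hg := gibbs_diagonal_mul_diagonal (G := G) hu hβ hf0 (by rw [hf2]; norm_num) x y
  rw [← hD, hf2] at hg
  set P := (loopMeasure G u β ((n : ℝ) + 1)).real (sameLoop G β x y 0)
  have hP : 0 ≤ P := measureReal_nonneg
  set L := Real.log ((G.dist x y : ℝ) + 1)
  -- The constant is `768 = 128 * 6`, from the Mermin–Wagner estimate and the energy of the profile.
  have hgn : ‖gibbs G n u β (oneSite x (Matrix.single a a 1 - Matrix.single b b 1) *
      oneSite y (Matrix.single a a 1 - Matrix.single b b 1))‖ ^ 2 ≤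
      768 * β * (n + 3) * C ^ 2 / L := by
    rw [gibbs, norm_div, div_pow]
    set Z := (NormedSpace.exp (-((β : ℂ) • hamiltonian G n u))).trace
    have hZ : Z.re ^ 2 ≤ ‖Z‖ ^ 2 := by
      rw [← sq_abs Z.re]
      exact pow_le_pow_left₀ (abs_nonneg _) (Complex.abs_re_le_norm Z) 2
    refine div_le_of_le_mul₀ (sq_nonneg _) (by positivity) (hmw.trans ?_)
    calc _ ≤ 128 * β * (n + 3) * (6 * C ^ 2 / L) * ‖Z‖ ^ 2 := by gcongr
      _ = _ := by ring
  rw [hg, Complex.norm_real, Real.norm_eq_abs, sq_abs] at hgn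
  have h1 := Real.le_sqrt_of_sq_le hgn
  rw [Real.sqrt_div' _ hL.le] at h1
  have hn0 : (0 : ℝ) < (n : ℝ) + 1 := by positivity
  calc P = ((n : ℝ) + 1) / 2 * (2 / ((n : ℝ) + 1) * P) := by field_simp
    _ ≤ ((n : ℝ) + 1) / 2 * (√(768 * β * (n + 3) * C ^ 2) / √L) := by gcongr
    _ = _ := by ring

end QuantumSpin

/-! ### The main theorem -/

theorem tendsto_div_sqrt_log_succ (K : ℝ) :
    Filter.Tendsto (fun d : ℕ => K / √(Real.log ((d : ℝ) + 1))) Filter.atTop (nhds 0) := by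
  refine Filter.Tendsto.const_div_atTop ?_ K
  refine Real.tendsto_sqrt_atTop.comp (Real.tendsto_log_atTop.comp ?_)
  exact Filter.tendsto_atTop_add_const_right _ _ tendsto_natCast_atTop_atTop

theorem mainTheorem4 (C u β : ℝ) (hu : u ∈ Set.Icc (0 : ℝ) 1) (hβ : 0 ≤ β) (n : ℕ)
    (S : ℝ) (hS : S = (n : ℝ) / 2) :
    -- decay of correlations
    (∃ K : ℝ, ∀ (Λ : Type w) [Fintype Λ] [DecidableEq Λ] (G : SimpleGraph Λ) [DecidableRel G.Adj],
      Is2DLike G C → ∀ x y : Λ,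
        QuantumSpin.gibbs G n u β
            (QuantumSpin.oneSite x (QuantumSpin.spin3 n) *
              QuantumSpin.oneSite y (QuantumSpin.spin3 n)) =
          ((1 / 3 * S * (S + 1) *
            (RandomLoops.loopMeasure G u β (2 * S + 1)).real
              (RandomLoops.sameLoop G β x y 0) : ℝ) : ℂ) ∧
        (x ≠ y → G.Reachable x y →
          1 / 3 * S * (S + 1) *
            (RandomLoops.loopMeasure G u β (2 * S + 1)).real
              (RandomLoops.sameLoop G β x y 0) ≤
            K / Real.sqrt (Real.log ((G.dist x y : ℝ) + 1))) ∧
        (¬ G.Reachable x y →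
          1 / 3 * S * (S + 1) *
            (RandomLoops.loopMeasure G u β (2 * S + 1)).real
              (RandomLoops.sameLoop G β x y 0) = 0)) ∧
    -- absence of macroscopic loops for `θ = 2, 3, 4, …`
    (1 ≤ n → ∀ ε : ℝ, 0 < ε → ∃ N : ℕ,
      ∀ (Λ : Type w) [Fintype Λ] [DecidableEq Λ] (G : SimpleGraph Λ),
        Is2DLike G C → N ≤ Fintype.card Λ → ∀ x : Λ,
          (∑ y : Λ, (RandomLoops.loopMeasure G u β (2 * S + 1)).real
            (RandomLoops.sameLoop G β x y 0)) / (Fintype.card Λ : ℝ) ≤ ε) := by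
  have hθ : 2 * S + 1 = (n : ℝ) + 1 := by rw [hS]; ring
  have hc : 1 / 3 * S * (S + 1) = n * (n + 2) / 12 := by rw [hS]; ring
  rw [hθ, hc]
  set K := ((n : ℝ) + 1) / 2 * √(768 * β * (n + 3) * C ^ 2) with hK
  refine ⟨⟨n * (n + 2) / 12 * K, fun Λ _ _ G _ hG x y => ⟨?_, fun hxy hr => ?_, fun hr => ?_⟩⟩,
    fun hn ε hε => ?_⟩
  · exact QuantumSpin.gibbs_spin3_mul_spin3 hu hβ x y
  · rcases Nat.eq_zero_or_pos n with rfl | hn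
    · simp
    · refine (mul_le_mul_of_nonneg_left
        (QuantumSpin.loopMeasure_sameLoop_le hu hβ hn hG hxy hr) (by positivity)).trans_eq ?_
      rw [mul_div_assoc _ K, hK]
  · simp [RandomLoops.sameLoop_eq_empty hr]
  -- From distance `R` on, each probability is at most `ε / 2`. The site `x` and the sites at
  -- distance from `1` to `R` number at most `1 + B`, and `N` is chosen so that `1 + B ≤ (ε / 2)
  -- |Λ|`.
  · obtain ⟨R, hR⟩ := Filter.eventually_atTop.1
      ((tendsto_div_sqrt_log_succ K).eventually_le_const (half_pos hε))
    set B := ∑ k ∈ Finset.Icc 1 R, C * k * 1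
    obtain ⟨N, hN⟩ := exists_nat_ge ((1 + B) / (ε / 2))
    refine ⟨N, fun Λ _ _ G hG hcard x => ?_⟩
    have hpos : (0 : ℝ) < Fintype.card Λ := by exact_mod_cast Fintype.card_pos_iff.2 ⟨x⟩
    rw [div_le_iff₀ hpos]
    have hB : 1 + B ≤ ε / 2 * Fintype.card Λ := by
      rw [div_le_iff₀' (half_pos hε)] at hN
      refine hN.trans (mul_le_mul_of_nonneg_left ?_ (half_pos hε).le)
      exact_mod_cast hcard
    -- Near sites are bounded by the trivial probability bound, far ones by the decay. Unreachable
    -- sites, whose `dist` is `0`, have probability zero.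
    have hpt : ∀ y, (RandomLoops.loopMeasure G u β ((n : ℝ) + 1)).real
        (RandomLoops.sameLoop G β x y 0) ≤ (if y = x then 1 else 0) +
          (if G.dist x y ∈ Finset.Icc 1 R then 1 else 0) + ε / 2 := by
      intro y
      have h1 := RandomLoops.loopMeasure_real_le_one (G := G) u β ((n : ℝ) + 1)
        (RandomLoops.sameLoop G β x y 0)
      have i1 : (0 : ℝ) ≤ if y = x then 1 else 0 := by split_ifs <;> norm_num
      have i2 : (0 : ℝ) ≤ if G.dist x y ∈ Finset.Icc 1 R then 1 else 0 := by
        split_ifs <;> norm_num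
      by_cases hyx : y = x
      · rw [if_pos hyx]; linarith
      by_cases hr : G.Reachable x y
      · have hd : 1 ≤ G.dist x y := hr.pos_dist_of_ne (Ne.symm hyx)
        by_cases hdR : G.dist x y ≤ R
        · rw [if_pos (Finset.mem_Icc.2 ⟨hd, hdR⟩)]; linarith
        · have h2 := QuantumSpin.loopMeasure_sameLoop_le hu hβ hn hG (Ne.symm hyx) hr
          have h3 := hR _ (le_of_not_ge hdR)
          linarith
      · rw [RandomLoops.sameLoop_eq_empty hr, measureReal_empty]
        linarith [half_pos hε]
    refine (Finset.sum_le_sum fun y _ => hpt y).trans ?_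
    have hrad := hG.sum_radial_le x R (g := fun _ => 1) fun _ => zero_le_one
    rw [Finset.sum_add_distrib, Finset.sum_add_distrib, Finset.sum_const, nsmul_eq_mul,
      Finset.sum_ite_eq' Finset.univ x, if_pos (Finset.mem_univ x), Finset.card_univ]
    linarith
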